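/- **Setting.** A static hard star consists of $B>0$ and continuous functions $r_0,m_0,\rho_0$ on $[0,B]$ with $r_0(0)=m_0(0)=0$, $\rho_0(B)=1$, $\rho_0\ge 1$, and $r_0>0$, $2m_0<r_0$ on $(0,B]$, that satisfy on $(0,B]$ $$\partial_\chi r_0=\frac{\sqrt{1-2m_0/r_0}}{4\pi r_0^2\sqrt{2\rho_0-1}},\qquad \partial_\chi m_0=4\pi r_0^2\rho_0\,\partial_\chi r_0,\qquad \partial_\chi\rho_0=-\frac{2\rho_0-1}{1-\frac{2m_0}{r_0}}\,F_0\,\partial_\chi r_0,$$ where $F_0:=\frac{m_0}{r_0^2}+4\pi r_0(\rho_0-1)$. Put $\psi_0:=-\frac12\log(2\rho_0-1)$ and $q_0:=\partial_\chi\psi_0/\partial_\chi r_0$. A solution of the master wave equation is a function $r_1=r_1(\phi,\chi)$ such that $r_1$ and $\partial_\phi r_1$ are continuous on $[0,\infty)\times[0,B]$, $r_1$ is $C^2$ on $[0,\infty)\times(0,B]$, $r_1=0$ at $\chi=0$, and on $[0,\infty)\times(0,B]$ $$(2\rho_0-1)\partial_\phi^2r_1-\frac{F_0}{\partial_\chi\psi_0}\,\partial_\chi\Bigl(\frac{\partial_\chi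 r_1}{\partial_\chi r_0}\Bigr)=\Bigl[2q_0F_0+\frac{2m_0}{r_0^3}+4\pi r_0(2\rho_0-1)\Bigl(\frac{2}{r_0}-q_0\Bigr)\Bigr]r_1+\frac{F_0}{\partial_\chi\psi_0}\,\partial_\chi\Bigl[\Bigl(\frac{2}{r_0}-q_0\Bigr)r_1\Bigr]+\Bigl(4\pi r_0\rho_0-\frac{m_0}{r_0^2}\Bigr)\frac{\partial_\chi r_1}{\partial_\chi r_0}.$$ Associated with $r_1$ are $$\psi_1=\Bigl(\frac{2}{r_0}-q_0\Bigr)r_1+\frac{\partial_\chi r_1}{\partial_\chi r_0},\qquad \omega_1=\frac{\partial_\chi r_1}{\partial_\chi r_0}-q_0r_1,\qquad \rho_1=-(2\rho_0-1)\psi_1=\sqrt{2\rho_0-1}\;n_1.$$ **Proposition 4.2.** There is an $\varepsilon>0$ such that for every static hard star with radius $r_0(B)<\varepsilon$ and central density $\rho_0(0)<1+\varepsilon$ there is a constant $C>0$, depending only on the star, with the following property. Let $r_1$ be a solution of the master wave equation that satisfies at $\chi=B$, for all $\phi\ge0$, the boundary condition $$\partial_\chi r_1=\Bigl(\frac{\partial_\chi\psi_0}{\partial_\chi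 r_0}-\frac{2}{r_0}\Bigr)r_1,$$ or, instead, satisfies there for all $\phi\ge 0$ the condition $\partial_\chi r_1=\partial_\chi r_0\bigl(\frac{\partial_\chi\psi_0}{\partial_\chi r_0}-\frac{2}{r_0}\bigr)r_1$, that is, $\psi_1=0$. Then for all $\phi\ge 0$ $$\mathcal E(\phi):=\int_0^B\Bigl[\frac{r_1^2}{r_0^2}+(\partial_\phi r_1)^2+r_0^4(\partial_\chi r_1)^2\Bigr]d\chi\le C\,\mathcal E(0)\qquad\text{and}\qquad \int_0^B\bigl(\rho_1^2+n_1^2+\psi_1^2+\omega_1^2\bigr)\,d\chi\le C\,\mathcal E(0),$$ where the integrals take values in $[0,\infty]$. -/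

import Mathlib

noncomputable section

/-- A static star made of fluid in the hard phase (`p = ρ - 1`, `ρ ≥ 1`), described in the comoving
coordinate `χ ∈ [0, B]`: precisely `χ` particles lie inside the sphere labelled `χ`.
Here `r` is the area radius, `m` the Hawking mass and `ρ` the energy density; the particle density
is `n = √(2ρ - 1)`. All derivatives with respect to `χ` are one-sided at `χ = B`. -/
structure HardStar where
  /-- the total number of particles -/
  B : ℝ
  r : ℝ → ℝ
  m : ℝ → ℝ
  ρ : ℝ → ℝ
  B_pos : 0 < B
  continuousOn_r : ContinuousOn r (Set.Icc 0 B)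
  continuousOn_m : ContinuousOn m (Set.Icc 0 B)
  continuousOn_ρ : ContinuousOn ρ (Set.Icc 0 B)
  /-- the center -/
  r_zero : r 0 = 0
  m_zero : m 0 = 0
  /-- the pressure vanishes on the boundary of the star -/
  ρ_boundary : ρ B = 1
  /-- the fluid is in the hard phase -/
  one_le_ρ : ∀ χ ∈ Set.Icc 0 B, 1 ≤ ρ χ
  r_pos : ∀ χ ∈ Set.Ioc 0 B, 0 < r χ
  /-- there are no trapped shells -/
  two_m_lt_r : ∀ χ ∈ Set.Ioc 0 B, 2 * m χ < r χ
  /-- the choice of the coordinate `χ`, i.e. `n = √(1 - 2m/r) / (4π r² ∂_χ r)` -/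
  hasDeriv_r : ∀ χ ∈ Set.Ioc 0 B,
    HasDerivWithinAt r
      (√(1 - 2 * m χ / r χ) / (4 * Real.pi * r χ ^ 2 * √(2 * ρ χ - 1))) (Set.Icc 0 B) χ
  /-- the mass equation `dm/dr = 4π r² ρ` -/
  hasDeriv_m : ∀ χ ∈ Set.Ioc 0 B,
    HasDerivWithinAt m
      (4 * Real.pi * r χ ^ 2 * ρ χ * derivWithin r (Set.Icc 0 B) χ) (Set.Icc 0 B) χ
  /-- the Tolman-Oppenheimer-Volkoff equation
  `dρ/dr = -(2ρ - 1) / (1 - 2m/r) * (m/r² + 4π r (ρ - 1))` -/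
  hasDeriv_ρ : ∀ χ ∈ Set.Ioc 0 B,
    HasDerivWithinAt ρ
      (-((2 * ρ χ - 1) / (1 - 2 * m χ / r χ)) *
        (m χ / r χ ^ 2 + 4 * Real.pi * r χ * (ρ χ - 1)) *
          derivWithin r (Set.Icc 0 B) χ) (Set.Icc 0 B) χ

namespace HardStar

variable (S : HardStar)

/-- The radius of the boundary. -/
def radius : ℝ := S.r S.B

/-- The derivative with respect to `χ ∈ [0, B]`. -/
def dChi (f : ℝ → ℝ) (χ : ℝ) : ℝ := derivWithin f (Set.Icc 0 S.B) χ

/-- The metric coefficient `ψ₀` of the star, given by `2ρ₀ - 1 = e^{-2ψ₀}`. -/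
def psi (χ : ℝ) : ℝ := -(1 / 2) * Real.log (2 * S.ρ χ - 1)

/-- The quotient `∂_χ ψ₀ / ∂_χ r₀`. -/
def psiSlope (χ : ℝ) : ℝ := S.dChi S.psi χ / S.dChi S.r χ

/-- The expression `m₀/r₀² + 4π r₀ (ρ₀ - 1)`. -/
def force (χ : ℝ) : ℝ := S.m χ / S.r χ ^ 2 + 4 * Real.pi * S.r χ * (S.ρ χ - 1)

end HardStar

/-- The derivative with respect to the time `φ ∈ [0, ∞)` (one-sided at `φ = 0`). -/
def dPhi (u : ℝ → ℝ → ℝ) (φ χ : ℝ) : ℝ := derivWithin (fun s => u s χ) (Set.Ici 0) φ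

namespace HardStar

variable (S : HardStar)

/-- The master wave equation for the linearised radius `u = r₁` at the point `(φ, χ)`. -/
def MasterEquationAt (u : ℝ → ℝ → ℝ) (φ χ : ℝ) : Prop :=
  (2 * S.ρ χ - 1) * dPhi (dPhi u) φ χ
      - S.force χ * (1 / S.dChi S.psi χ) *
          S.dChi (fun x => S.dChi (u φ) x / S.dChi S.r x) χ
    = (2 * S.psiSlope χ * S.force χ + 2 * (S.m χ / S.r χ ^ 3)
          + 4 * Real.pi * S.r χ * (2 * S.ρ χ - 1) * (2 / S.r χ - S.psiSlope χ)) * u φ χ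
      + S.force χ * (1 / S.dChi S.psi χ) *
          S.dChi (fun x => (2 / S.r x - S.psiSlope x) * u φ x) χ
      + (4 * Real.pi * S.r χ * S.ρ χ - S.m χ / S.r χ ^ 2) * (S.dChi (u φ) χ / S.dChi S.r χ)

/-- A global classical solution `u = r₁` of the master wave equation on `φ ≥ 0`, `0 < χ ≤ B`, which
vanishes at the center. It is `C²` away from the center; at the center (where `∂_χ r₀` is infinite)
only continuity of `r₁` and of `∂_φ r₁` is required. -/
structure IsMasterSolution (u : ℝ → ℝ → ℝ) : Prop where
  contDiffOn : ContDiffOn ℝ 2 (Function.uncurry u) (Set.Ici 0 ×ˢ Set.Ioc 0 S.B)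
  continuousOn : ContinuousOn (Function.uncurry u) (Set.Ici 0 ×ˢ Set.Icc 0 S.B)
  continuousOn_dPhi : ContinuousOn (Function.uncurry (dPhi u)) (Set.Ici 0 ×ˢ Set.Icc 0 S.B)
  equation : ∀ φ ∈ Set.Ici (0 : ℝ), ∀ χ ∈ Set.Ioc 0 S.B, S.MasterEquationAt u φ χ
  center : ∀ φ ∈ Set.Ici (0 : ℝ), u φ 0 = 0

/-- The condition `∂_χ r₁ = κ (∂_χ ψ₀ / ∂_χ r₀ - 2 / r₀) r₁` at `χ = B`, for all `φ ≥ 0`. -/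
def BoundaryCondition (κ : ℝ) (u : ℝ → ℝ → ℝ) : Prop :=
  ∀ φ ∈ Set.Ici (0 : ℝ),
    S.dChi (u φ) S.B = κ * (S.psiSlope S.B - 2 / S.r S.B) * u φ S.B

/-- The energy `∫₀ᴮ [r₁²/r₀² + (∂_φ r₁)² + r₀⁴ (∂_χ r₁)²] dχ`, with values in `[0, ∞]`. -/
def energy (u : ℝ → ℝ → ℝ) (φ : ℝ) : ENNReal :=
  ∫⁻ χ in Set.Ioc 0 S.B, ENNReal.ofReal
    (u φ χ ^ 2 / S.r χ ^ 2 + dPhi u φ χ ^ 2 + S.r χ ^ 4 * S.dChi (u φ) χ ^ 2)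

/-- The linearised metric coefficient `ψ₁`. -/
def linPsi (u : ℝ → ℝ → ℝ) (φ χ : ℝ) : ℝ :=
  (2 / S.r χ - S.psiSlope χ) * u φ χ + S.dChi (u φ) χ / S.dChi S.r χ

/-- The linearised metric coefficient `ω₁`. -/
def linOmega (u : ℝ → ℝ → ℝ) (φ χ : ℝ) : ℝ :=
  S.dChi (u φ) χ / S.dChi S.r χ - S.psiSlope χ * u φ χ

/-- The linearised energy density `ρ₁`. -/
def linRho (u : ℝ → ℝ → ℝ) (φ χ : ℝ) : ℝ := -S.linPsi u φ χ * (2 * S.ρ χ - 1)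

/-- The linearised particle density `n₁`, given by `ρ₁ = n₁ √(2ρ₀ - 1)`. -/
def linN (u : ℝ → ℝ → ℝ) (φ χ : ℝ) : ℝ := S.linRho u φ χ / √(2 * S.ρ χ - 1)

end HardStar

end

open Set MeasureTheory Filter Topology

/-! Write `g = ∂_χ r₀` and `a = 1 - 2m₀/r₀`. Since `F₀/∂_χψ₀ = a/g`, dividing the master equation by
`a` absorbs all first-order terms and leaves the divergence form `κ ∂_φ²r₁ = ∂_χ(P ∂_χr₁) - W r₁`
with `κ = (2ρ₀-1)/a` and `P = g⁻²` (`hasDerivAt_stiffness_mul_dChi`). For a small star of nearly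
constant density, `κ` lies between 1 and 2, `P` is comparable to `r₀⁴`, and `W` is comparable to
`1/r₀²` because the singular term `2/r₀²` dominates it (`coefficient_bounds`, `stiffness_bounds`).
Thus the natural energy density `κ(∂_φr₁)² + P(∂_χr₁)² + W r₁²` is equivalent to the integrand of
`𝓔`.

Its integral changes only through flux at the two ends. At `χ = B` both boundary conditions read `P
∂_χr₁ = -c r₁` with `c ≥ 0`, so the flux is the time derivative of `-c r₁²/2`; the initial boundary
value is controlled by `𝓔(0)` through a trace inequality.

The delicate end is the center, where only boundedness of `r₁` and `∂_φr₁` is available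
(`exists_abs_flux_lt`). It suffices that the time-integrated flux gets arbitrarily small at points
arbitrarily close to 0. Otherwise `P ≤ K x` forces `∫ P (∂_xu)² dt ≥ α/x`. Then `G = ∫ P u ∂_xu dt`
has derivative at least `α/x - C`, so `G ≤ -1` near 0. Hence `∂_x ∫ u² dt = 2G/P ≤ -2/(Kx)`, and `∫
u² dt` blows up logarithmically, which contradicts boundedness.

The fields `ψ₁, ω₁, ρ₁, n₁` are bounded pointwise by the integrand of `𝓔`. -/

/-! ### Calculus in one variable and differentiation under the integral -/

/-- The function `f - α log x + C x` is nondecreasing, so near 0 it stays below its value at `b/2`,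
and `α log x` drags `f` to `-∞`. It is applied twice in the argument at the center. -/
theorem eventually_le_of_deriv_ge_div {f f' : ℝ → ℝ} {b α C : ℝ} (hb : 0 < b) (hα : 0 < α)
    (hd : ∀ x ∈ Ioo 0 b, HasDerivAt f (f' x) x) (hf' : ∀ x ∈ Ioo 0 b, α / x - C ≤ f' x) (A : ℝ) :
    ∃ δ ∈ Ioo 0 b, ∀ x ∈ Ioo 0 δ, f x ≤ A := by
  have hmono : MonotoneOn (fun x => f x - α * Real.log x + C * x) (Ioo 0 b) := by
    have hg : ∀ x ∈ Ioo 0 b,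
        HasDerivAt (fun x => f x - α * Real.log x + C * x) (f' x - α * x⁻¹ + C * 1) x :=
      fun x hx => ((hd x hx).sub ((Real.hasDerivAt_log hx.1.ne').const_mul α)).add
        ((hasDerivAt_id x).const_mul C)
    refine monotoneOn_of_deriv_nonneg (convex_Ioo 0 b)
      (fun x hx => (hg x hx).continuousAt.continuousWithinAt) ?_ ?_
    · rw [interior_Ioo]
      exact fun x hx => (hg x hx).differentiableAt.differentiableWithinAt
    · rw [interior_Ioo]
      intro x hx
      rw [(hg x hx).deriv]
      have := hf' x hx
      rw [div_eq_mul_inv] at this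
      linarith
  set g : ℝ → ℝ := fun x => f x - α * Real.log x + C * x with hgdef
  have hlog := (Real.tendsto_log_nhdsGT_zero.eventually
    (eventually_le_atBot ((A - g (b / 2) - |C| * b) / α)))
  obtain ⟨δ, hδ, hδ'⟩ := (mem_nhdsGT_iff_exists_Ioo_subset' (show (0 : ℝ) < b / 2 by linarith)).1 hlog
  refine ⟨min δ (b / 2), ⟨lt_min hδ (by linarith), by
    have := min_le_right δ (b / 2); linarith⟩, fun x hx => ?_⟩
  have hx1 : x < δ := hx.2.trans_le (min_le_left _ _)
  have hx2 : x < b / 2 := hx.2.trans_le (min_le_right _ _)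
  have h1 : g x ≤ g (b / 2) := hmono ⟨hx.1, by linarith⟩ ⟨by linarith, by linarith⟩ hx2.le
  have h2 : Real.log x ≤ (A - g (b / 2) - |C| * b) / α := hδ' ⟨hx.1, hx1⟩
  rw [le_div_iff₀ hα] at h2
  have h3 : -(C * x) ≤ |C| * b := by
    calc -(C * x) ≤ |C * x| := neg_le_abs _
      _ = |C| * x := by rw [abs_mul, abs_of_pos hx.1]
      _ ≤ |C| * b := by gcongr; linarith
  have h4 : g x = f x - α * Real.log x + C * x := rfl
  nlinarith

theorem hasDerivAt_intervalIntegral_of_continuousOn {f f' : ℝ → ℝ → ℝ} {B T x : ℝ} (hT : 0 ≤ T)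
    (hx : x ∈ Ioo 0 B) (hf : ∀ y ∈ Ioo 0 B, ContinuousOn (fun t => f t y) (Icc 0 T))
    (hf' : ContinuousOn (Function.uncurry f') (Icc 0 T ×ˢ Ioo 0 B))
    (hd : ∀ t ∈ Icc 0 T, ∀ y ∈ Ioo 0 B, HasDerivAt (f t) (f' t y) y) :
    HasDerivAt (fun y => ∫ t in 0..T, f t y) (∫ t in 0..T, f' t x) x := by
  obtain ⟨a, b, ⟨hax, hxb⟩, hab⟩ : ∃ a b, x ∈ Ioo a b ∧ Icc a b ⊆ Ioo 0 B :=
    ⟨x / 2, (x + B) / 2, ⟨by linarith [hx.1], by linarith [hx.2]⟩,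
      fun y hy => ⟨by linarith [hx.1, hy.1], by linarith [hx.2, hy.2]⟩⟩
  have hsub : Icc 0 T ×ˢ Icc a b ⊆ Icc 0 T ×ˢ Ioo 0 B := prod_mono_right hab
  obtain ⟨C, hC⟩ := (isCompact_Icc.prod isCompact_Icc).exists_bound_of_continuousOn
    (hf'.mono hsub)
  have hslice : ContinuousOn (fun t => f' t x) (Icc 0 T) :=
    hf'.comp (f := fun t => (t, x)) (by fun_prop) (fun t ht => ⟨ht, hx⟩)
  have hIoc : Set.uIoc 0 T = Ioc 0 T := uIoc_of_le hT
  refine (intervalIntegral.hasDerivAt_integral_of_dominated_loc_of_deriv_le (F := fun y t => f t y)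
    (F' := fun y t => f' t y) (bound := fun _ => C) (s := Ioo a b) (Ioo_mem_nhds hax hxb)
    ?_ ?_ ?_ ?_ ?_ ?_).2
  · filter_upwards [Ioo_mem_nhds hax hxb] with y hy
    rw [hIoc]
    exact ((hf y (hab (Ioo_subset_Icc_self hy))).mono Ioc_subset_Icc_self).aestronglyMeasurable
      measurableSet_Ioc
  · exact (hf x hx).intervalIntegrable_of_Icc hT
  · rw [hIoc]
    exact (hslice.mono Ioc_subset_Icc_self).aestronglyMeasurable measurableSet_Ioc
  · refine Eventually.of_forall fun t ht y hy => ?_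
    rw [hIoc] at ht
    exact hC (t, y) ⟨Ioc_subset_Icc_self ht, Ioo_subset_Icc_self hy⟩
  · exact intervalIntegrable_const
  · refine Eventually.of_forall fun t ht y hy => ?_
    rw [hIoc] at ht
    exact hd t (Ioc_subset_Icc_self ht) y (hab (Ioo_subset_Icc_self hy))

/-! ### Energy estimate for a degenerate wave equation -/

/-- A classical solution `u`, with time derivative `p` and space derivative `q`, of the wave equation
`κ ∂ₜ²u = ∂ₓ(P ∂ₓu) - W u` on `[0, ∞) × (0, B)`, whose coefficient `P` degenerates at `x = 0`. -/
structure IsDegenerateWave (B K : ℝ) (κ P W : ℝ → ℝ) (u p q pt px : ℝ → ℝ → ℝ) : Prop where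
  B_pos : 0 < B
  K_pos : 0 < K
  contκ : ContinuousOn κ (Ioc 0 B)
  contP : ContinuousOn P (Ioc 0 B)
  contW : ContinuousOn W (Ioc 0 B)
  κ_nonneg : ∀ x ∈ Ioc 0 B, 0 ≤ κ x
  κ_le : ∀ x ∈ Ioc 0 B, κ x ≤ K
  P_pos : ∀ x ∈ Ioc 0 B, 0 < P x
  P_le : ∀ x ∈ Ioc 0 B, P x ≤ K * x
  W_nonneg : ∀ x ∈ Ioc 0 B, 0 ≤ W x
  contu : ContinuousOn (Function.uncurry u) (Ici 0 ×ˢ Ioc 0 B)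
  contp : ContinuousOn (Function.uncurry p) (Ici 0 ×ˢ Ioc 0 B)
  contq : ContinuousOn (Function.uncurry q) (Ici 0 ×ˢ Ioc 0 B)
  contpt : ContinuousOn (Function.uncurry pt) (Ici 0 ×ˢ Ioc 0 B)
  contpx : ContinuousOn (Function.uncurry px) (Ici 0 ×ˢ Ioc 0 B)
  u_t : ∀ t ∈ Ici (0 : ℝ), ∀ x ∈ Ioc 0 B, HasDerivWithinAt (fun s => u s x) (p t x) (Ici 0) t
  p_t : ∀ t ∈ Ici (0 : ℝ), ∀ x ∈ Ioc 0 B, HasDerivWithinAt (fun s => p s x) (pt t x) (Ici 0) t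
  q_t : ∀ t ∈ Ici (0 : ℝ), ∀ x ∈ Ioc 0 B, HasDerivWithinAt (fun s => q s x) (px t x) (Ici 0) t
  u_x : ∀ t ∈ Ici (0 : ℝ), ∀ x ∈ Ioo 0 B, HasDerivAt (u t) (q t x) x
  p_x : ∀ t ∈ Ici (0 : ℝ), ∀ x ∈ Ioo 0 B, HasDerivAt (p t) (px t x) x
  equation : ∀ t ∈ Ici (0 : ℝ), ∀ x ∈ Ioo 0 B,
    HasDerivAt (fun y => P y * q t y) (κ x * pt t x + W x * u t x) x
  bounded : ∀ T, ∃ M, ∀ t ∈ Icc 0 T, ∀ x ∈ Ioc 0 B, |u t x| ≤ M ∧ |p t x| ≤ M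

namespace IsDegenerateWave

variable {B K : ℝ} {κ P W : ℝ → ℝ} {u p q pt px : ℝ → ℝ → ℝ}

theorem continuousOn_fst_slice {f : ℝ → ℝ → ℝ} {T x : ℝ}
    (hf : ContinuousOn (Function.uncurry f) (Ici 0 ×ˢ Ioc 0 B)) (hx : x ∈ Ioc 0 B) :
    ContinuousOn (fun t => f t x) (Icc 0 T) :=
  hf.comp (f := fun t => (t, x)) (by fun_prop) (fun _ ht => ⟨ht.1, hx⟩)

theorem continuousOn_snd_slice {f : ℝ → ℝ → ℝ} {t : ℝ}
    (hf : ContinuousOn (Function.uncurry f) (Ici 0 ×ˢ Ioc 0 B)) (ht : 0 ≤ t) :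
    ContinuousOn (fun x => f t x) (Ioc 0 B) :=
  hf.comp (f := fun x => (t, x)) (by fun_prop) (fun _ hx => ⟨ht, hx⟩)

theorem continuousOn_coeff {f : ℝ → ℝ} (hf : ContinuousOn f (Ioc 0 B)) :
    ContinuousOn (Function.uncurry fun _ x => f x) (Ici (0 : ℝ) ×ˢ Ioc 0 B) :=
  hf.comp (f := fun z : ℝ × ℝ => z.2) (by fun_prop) (fun _ hz => hz.2)

theorem Icc_prod_Ioo_subset (B T : ℝ) :
    Icc (0 : ℝ) T ×ˢ Ioo 0 B ⊆ Ici 0 ×ˢ Ioc 0 B :=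
  prod_mono (fun _ ht => ht.1) Ioo_subset_Ioc_self

/-- The energy density. -/
def density (κ P W : ℝ → ℝ) (u p q : ℝ → ℝ → ℝ) (t x : ℝ) : ℝ :=
  κ x * p t x ^ 2 + P x * q t x ^ 2 + W x * u t x ^ 2

/-- The energy that has flowed through `x` up to the time `T`. -/
noncomputable def flux (P : ℝ → ℝ) (p q : ℝ → ℝ → ℝ) (T x : ℝ) : ℝ := ∫ t in 0..T, P x * q t x * p t x


/-- Local energy conservation, from the multiplier `p`: `∂ₓ(P q p)` equals half the time derivative
of the density, and integration in time leaves the values at `0` and `T`. -/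
theorem hasDerivAt_flux (h : IsDegenerateWave B K κ P W u p q pt px) {T x : ℝ} (hT : 0 ≤ T)
    (hx : x ∈ Ioo 0 B) :
    HasDerivAt (flux P p q T) ((density κ P W u p q T x - density κ P W u p q 0 x) / 2) x := by
  have hx' : x ∈ Ioc 0 B := Ioo_subset_Ioc_self hx
  have key := hasDerivAt_intervalIntegral_of_continuousOn (f := fun t x => P x * q t x * p t x)
    (f' := fun t x => (κ x * pt t x + W x * u t x) * p t x + P x * q t x * px t x) hT hx
    (fun y hy => ?_) ?_ (fun t ht y hy => ?_)
  · have hderiv : ∀ t ∈ Icc 0 T, HasDerivWithinAt (fun t => density κ P W u p q t x / 2)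
        ((κ x * pt t x + W x * u t x) * p t x + P x * q t x * px t x) (Ici 0) t := by
      intro t ht
      have h1 := h.p_t t ht.1 x hx'
      have h2 := h.q_t t ht.1 x hx'
      have h3 := h.u_t t ht.1 x hx'
      have := ((((h1.pow 2).const_mul (κ x)).add ((h2.pow 2).const_mul (P x))).add
        ((h3.pow 2).const_mul (W x))).div_const 2
      refine this.congr_deriv ?_
      push_cast
      ring
    have hint : ∫ t in 0..T, ((κ x * pt t x + W x * u t x) * p t x + P x * q t x * px t x)
        = density κ P W u p q T x / 2 - density κ P W u p q 0 x / 2 := by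
      refine intervalIntegral.integral_eq_sub_of_hasDerivAt_of_le hT
        (fun t ht => ((hderiv t ht).mono Icc_subset_Ici_self).continuousWithinAt)
        (fun t ht => (hderiv t (Ioo_subset_Icc_self ht)).hasDerivAt (Ici_mem_nhds ht.1)) ?_
      refine ContinuousOn.intervalIntegrable_of_Icc hT ?_
      have c1 := continuousOn_fst_slice (T := T) h.contu hx'
      have c2 := continuousOn_fst_slice (T := T) h.contp hx'
      have c3 := continuousOn_fst_slice (T := T) h.contq hx'
      have c4 := continuousOn_fst_slice (T := T) h.contpt hx'
      have c5 := continuousOn_fst_slice (T := T) h.contpx hx'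
      fun_prop
    rw [hint] at key
    exact key.congr_deriv (by ring)
  · have hy' : y ∈ Ioc 0 B := Ioo_subset_Ioc_self hy
    have c2 := continuousOn_fst_slice (T := T) h.contp hy'
    have c3 := continuousOn_fst_slice (T := T) h.contq hy'
    fun_prop
  · refine ContinuousOn.mono ?_ (Icc_prod_Ioo_subset B T)
    have c1 := h.contu
    have c2 := h.contp
    have c3 := h.contq
    have c4 := h.contpt
    have c5 := h.contpx
    have c6 := continuousOn_coeff h.contκ
    have c7 := continuousOn_coeff h.contP
    have c8 := continuousOn_coeff h.contW
    exact (((c6.mul c4).add (c8.mul c1)).mul c2).add ((c7.mul c3).mul c5)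
  · exact (h.equation t ht.1 y hy).mul (h.p_x t ht.1 y hy)

theorem hasDerivAt_integral_sq (h : IsDegenerateWave B K κ P W u p q pt px) {T x : ℝ} (hT : 0 ≤ T)
    (hx : x ∈ Ioo 0 B) :
    HasDerivAt (fun x => ∫ t in 0..T, u t x ^ 2) (∫ t in 0..T, 2 * u t x * q t x) x := by
  refine hasDerivAt_intervalIntegral_of_continuousOn (f := fun t x => u t x ^ 2)
    (f' := fun t x => 2 * u t x * q t x) hT hx (fun y hy => ?_) ?_ (fun t ht y hy => ?_)
  · have c1 := continuousOn_fst_slice (T := T) h.contu (Ioo_subset_Ioc_self hy)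
    fun_prop
  · refine ContinuousOn.mono ?_ (Icc_prod_Ioo_subset B T)
    exact (continuousOn_const.mul h.contu).mul h.contq
  · refine ((h.u_x t ht.1 y hy).pow 2).congr_deriv ?_
    push_cast
    ring

/-- The virial identity, from the multiplier `u`; the term `κ pt u` is integrated by parts in time.
-/
theorem hasDerivAt_integral_mul (h : IsDegenerateWave B K κ P W u p q pt px) {T x : ℝ}
    (hT : 0 ≤ T) (hx : x ∈ Ioo 0 B) :
    HasDerivAt (fun x => ∫ t in 0..T, P x * q t x * u t x)
      ((∫ t in 0..T, (P x * q t x ^ 2 + W x * u t x ^ 2 - κ x * p t x ^ 2))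
        + κ x * (p T x * u T x - p 0 x * u 0 x)) x := by
  have hx' : x ∈ Ioc 0 B := Ioo_subset_Ioc_self hx
  have c1 := continuousOn_fst_slice (T := T) h.contu hx'
  have c2 := continuousOn_fst_slice (T := T) h.contp hx'
  have c3 := continuousOn_fst_slice (T := T) h.contq hx'
  have c4 := continuousOn_fst_slice (T := T) h.contpt hx'
  have key := hasDerivAt_intervalIntegral_of_continuousOn (f := fun t x => P x * q t x * u t x)
    (f' := fun t x => (κ x * pt t x + W x * u t x) * u t x + P x * q t x * q t x) hT hx
    (fun y hy => ?_) ?_ (fun t ht y hy => ?_)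
  · have hderiv : ∀ t ∈ Icc 0 T, HasDerivWithinAt (fun t => p t x * u t x)
        (pt t x * u t x + p t x * p t x) (Ici 0) t := fun t ht =>
      (h.p_t t ht.1 x hx').mul (h.u_t t ht.1 x hx')
    have hint : ∫ t in 0..T, (pt t x * u t x + p t x * p t x)
        = p T x * u T x - p 0 x * u 0 x := by
      refine intervalIntegral.integral_eq_sub_of_hasDerivAt_of_le hT
        (fun t ht => ((hderiv t ht).mono Icc_subset_Ici_self).continuousWithinAt)
        (fun t ht => (hderiv t (Ioo_subset_Icc_self ht)).hasDerivAt (Ici_mem_nhds ht.1)) ?_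
      refine ContinuousOn.intervalIntegrable_of_Icc hT ?_
      fun_prop
    refine key.congr_deriv ?_
    rw [← hint, ← intervalIntegral.integral_const_mul, ← intervalIntegral.integral_add]
    · congr 1
      ext t
      ring
    · exact ContinuousOn.intervalIntegrable_of_Icc hT (by fun_prop)
    · exact ContinuousOn.intervalIntegrable_of_Icc hT (by fun_prop)
  · have hy' : y ∈ Ioc 0 B := Ioo_subset_Ioc_self hy
    have c2 := continuousOn_fst_slice (T := T) h.contu hy'
    have c3 := continuousOn_fst_slice (T := T) h.contq hy'
    fun_prop
  · refine ContinuousOn.mono ?_ (Icc_prod_Ioo_subset B T)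
    have c1 := h.contu
    have c3 := h.contq
    have c4 := h.contpt
    have c6 := continuousOn_coeff h.contκ
    have c7 := continuousOn_coeff h.contP
    have c8 := continuousOn_coeff h.contW
    exact (((c6.mul c4).add (c8.mul c1)).mul c1).add ((c7.mul c3).mul c3)
  · exact (h.equation t ht.1 y hy).mul (h.u_x t ht.1 y hy)

/-- Young's inequality with weight `l` bounds the flux by `l ∫ P q²` plus a multiple of `P ∫ p² /
l`. As `P ≤ K x`, a weight proportional to `x` already makes the second term at most `c / 2`, whence
the factor `1 / x`. -/
theorem div_le_integral_of_le_flux (h : IsDegenerateWave B K κ P W u p q pt px) {T M x c : ℝ}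
    (hT : 0 ≤ T) (hx : x ∈ Ioo 0 B) (hM : ∀ t ∈ Icc 0 T, |p t x| ≤ M) (hc : 0 < c)
    (hflux : c ≤ |flux P p q T x|) :
    c ^ 2 / (K * (T * M ^ 2 + 1)) / x ≤ ∫ t in 0..T, P x * q t x ^ 2 := by
  have hx' : x ∈ Ioc 0 B := Ioo_subset_Ioc_self hx
  have hx0 : 0 < x := hx.1
  have hK := h.K_pos
  have c2 := continuousOn_fst_slice (T := T) h.contp hx'
  have c3 := continuousOn_fst_slice (T := T) h.contq hx'
  have hD : 0 < T * M ^ 2 + 1 := by positivity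
  -- The weight makes the error `T K x M² / (4l)` at most `c / 2`; the summand `1` keeps it positive
  -- when `T M² = 0`.
  set l : ℝ := K * x * (T * M ^ 2 + 1) / (2 * c) with hl
  have hl0 : 0 < l := by positivity
  have hpt : ∀ t ∈ Icc 0 T, |P x * q t x * p t x| ≤
      l * (P x * q t x ^ 2) + K * x * M ^ 2 / (4 * l) := by
    intro t ht
    have hP := h.P_pos x hx'
    have h1 : |P x * q t x * p t x| ≤ P x * (l * q t x ^ 2 + p t x ^ 2 / (4 * l)) := by
      rw [mul_assoc, abs_mul, abs_of_pos hP]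
      refine mul_le_mul_of_nonneg_left ?_ hP.le
      rw [abs_le]
      constructor
      · have : 0 ≤ l * (q t x + p t x / (2 * l)) ^ 2 := by positivity
        have e : l * (q t x + p t x / (2 * l)) ^ 2
          = l * q t x ^ 2 + p t x ^ 2 / (4 * l) + q t x * p t x := by
          field_simp
          ring
        linarith
      · have : 0 ≤ l * (q t x - p t x / (2 * l)) ^ 2 := by positivity
        have e : l * (q t x - p t x / (2 * l)) ^ 2
          = l * q t x ^ 2 + p t x ^ 2 / (4 * l) - q t x * p t x := by
          field_simp
          ring
        linarith
    have h2 : p t x ^ 2 ≤ M ^ 2 := by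
      rw [← sq_abs]
      exact pow_le_pow_left₀ (abs_nonneg _) (hM t ht) 2
    have h3 : P x * (p t x ^ 2 / (4 * l)) ≤ K * x * (M ^ 2 / (4 * l)) := by
      gcongr
      exact h.P_le x hx'
    calc _ ≤ _ := h1
      _ = l * (P x * q t x ^ 2) + P x * (p t x ^ 2 / (4 * l)) := by ring
      _ ≤ _ := by rw [mul_div_assoc (K * x)]; linarith
  have hI : |flux P p q T x| ≤ ∫ t in 0..T, (l * (P x * q t x ^ 2) + K * x * M ^ 2 / (4 * l)) := by
    refine (intervalIntegral.abs_integral_le_integral_abs hT).trans ?_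
    refine intervalIntegral.integral_mono_on hT ?_ ?_ hpt
    · exact ContinuousOn.intervalIntegrable_of_Icc hT (by fun_prop)
    · exact ContinuousOn.intervalIntegrable_of_Icc hT (by fun_prop)
  rw [intervalIntegral.integral_add
    (ContinuousOn.intervalIntegrable_of_Icc hT (by fun_prop)) intervalIntegrable_const,
    intervalIntegral.integral_const_mul, intervalIntegral.integral_const, smul_eq_mul] at hI
  set A := ∫ t in 0..T, P x * q t x ^ 2
  have h5 : (T - 0) * (K * x * M ^ 2 / (4 * l)) ≤ c / 2 := by
    have : (T - 0) * (K * x * M ^ 2 / (4 * l)) = c / 2 * (T * M ^ 2 / (T * M ^ 2 + 1)) := by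
      rw [hl]; field_simp; ring
    rw [this]
    have : T * M ^ 2 / (T * M ^ 2 + 1) ≤ 1 := by rw [div_le_one hD]; linarith
    nlinarith
  have h6 : c / 2 ≤ l * A := by linarith
  have h7 : c ^ 2 / (K * (T * M ^ 2 + 1)) / x = (c / 2) / l := by
    rw [hl]; field_simp
  rw [h7, div_le_iff₀ hl0]
  linarith

/-- No energy flows in from the center, as `u` is bounded there. -/
theorem exists_abs_flux_lt (h : IsDegenerateWave B K κ P W u p q pt px) {T c x₀ : ℝ} (hT : 0 ≤ T)
    (hc : 0 < c) (hx₀ : 0 < x₀) : ∃ x ∈ Ioo 0 x₀, |flux P p q T x| < c := by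
  by_contra! hcon
  obtain ⟨M, hM⟩ := h.bounded T
  have hK := h.K_pos
  have hB := h.B_pos
  set b := min x₀ B with hb
  have hb0 : 0 < b := lt_min hx₀ hB
  have hbx : b ≤ x₀ := min_le_left _ _
  have hbB : b ≤ B := min_le_right _ _
  have hsub : ∀ x ∈ Ioo 0 b, x ∈ Ioo 0 B := fun x hx => ⟨hx.1, hx.2.trans_le hbB⟩
  have hM0 : 0 ≤ M :=
    (abs_nonneg _).trans (hM 0 ⟨le_rfl, hT⟩ B ⟨hB, le_rfl⟩).1
  have hα : 0 < c ^ 2 / (K * (T * M ^ 2 + 1)) := by positivity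
  have hsq : ∀ t ∈ Icc 0 T, ∀ x ∈ Ioc 0 B, p t x ^ 2 ≤ M ^ 2 ∧ u t x ^ 2 ≤ M ^ 2 := by
    intro t ht x hx
    exact ⟨sq_le_sq' (neg_le_of_abs_le (hM t ht x hx).2) (le_of_abs_le (hM t ht x hx).2),
      sq_le_sq' (neg_le_of_abs_le (hM t ht x hx).1) (le_of_abs_le (hM t ht x hx).1)⟩
  -- In the virial identity the potential term is dropped by its sign; the kinetic term costs `T K
  -- M²` and the two time endpoints cost `2 K M²`.
  have hlow : ∀ x ∈ Ioo 0 b, c ^ 2 / (K * (T * M ^ 2 + 1)) / x - (T * (K * M ^ 2) + K * (2 * M ^ 2))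
      ≤ (∫ t in 0..T, (P x * q t x ^ 2 + W x * u t x ^ 2 - κ x * p t x ^ 2))
        + κ x * (p T x * u T x - p 0 x * u 0 x) := by
    intro x hx
    have hx' : x ∈ Ioc 0 B := Ioo_subset_Ioc_self (hsub x hx)
    have c1 := continuousOn_fst_slice (T := T) h.contu hx'
    have c2 := continuousOn_fst_slice (T := T) h.contp hx'
    have c3 := continuousOn_fst_slice (T := T) h.contq hx'
    have h1 := h.div_le_integral_of_le_flux hT (hsub x hx) (fun t ht => (hM t ht x hx').2) hc
      (hcon x ⟨hx.1, hx.2.trans_le hbx⟩)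
    have hκ0 := h.κ_nonneg x hx'
    have hκ1 := h.κ_le x hx'
    have hW0 := h.W_nonneg x hx'
    have h2 : (∫ t in 0..T, (P x * q t x ^ 2 - K * M ^ 2)) ≤
        ∫ t in 0..T, (P x * q t x ^ 2 + W x * u t x ^ 2 - κ x * p t x ^ 2) := by
      refine intervalIntegral.integral_mono_on hT
        (ContinuousOn.intervalIntegrable_of_Icc hT (by fun_prop))
        (ContinuousOn.intervalIntegrable_of_Icc hT (by fun_prop)) (fun t ht => ?_)
      have : κ x * p t x ^ 2 ≤ K * M ^ 2 :=
        mul_le_mul hκ1 (hsq t ht x hx').1 (sq_nonneg _) hK.le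
      have : 0 ≤ W x * u t x ^ 2 := by positivity
      linarith
    rw [intervalIntegral.integral_sub
      (ContinuousOn.intervalIntegrable_of_Icc hT (by fun_prop)) intervalIntegrable_const,
      intervalIntegral.integral_const, smul_eq_mul] at h2
    have h3 : -(2 * M ^ 2) ≤ p T x * u T x - p 0 x * u 0 x := by
      have a1 := hsq T ⟨hT, le_rfl⟩ x hx'
      have a2 := hsq 0 ⟨le_rfl, hT⟩ x hx'
      nlinarith [sq_nonneg (p T x + u T x), sq_nonneg (p 0 x - u 0 x)]
    have h4 : -(K * (2 * M ^ 2)) ≤ κ x * (p T x * u T x - p 0 x * u 0 x) := by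
      have : κ x * (2 * M ^ 2) ≤ K * (2 * M ^ 2) := by gcongr
      nlinarith
    linarith
  -- Any negative threshold serves here: what matters is that `∫ P q u` stays away from 0 with
  -- negative sign.
  obtain ⟨δ, hδ, hG⟩ := eventually_le_of_deriv_ge_div hb0 hα
    (fun x hx => h.hasDerivAt_integral_mul hT (hsub x hx)) hlow (-1)
  have hsubδ : ∀ x ∈ Ioo 0 δ, x ∈ Ioo 0 B := fun x hx => hsub x ⟨hx.1, hx.2.trans hδ.2⟩
  have hlow' : ∀ x ∈ Ioo 0 δ, 2 / K / x - 0 ≤ -∫ t in 0..T, 2 * u t x * q t x := by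
    intro x hx
    have hx' : x ∈ Ioc 0 B := Ioo_subset_Ioc_self (hsubδ x hx)
    have hPx := h.P_pos x hx'
    have hG' := hG x hx
    have e : ∫ t in 0..T, P x * q t x * u t x = P x / 2 * ∫ t in 0..T, 2 * u t x * q t x := by
      rw [← intervalIntegral.integral_const_mul]
      congr 1
      ext t
      ring
    simp only [e] at hG'
    have hx0 := hx.1
    have h3 : 2 / K / x ≤ 2 / P x := by
      rw [div_div]
      exact div_le_div_of_nonneg_left (by norm_num) hPx (h.P_le x hx')
    have h4 : 2 / P x ≤ -∫ t in 0..T, 2 * u t x * q t x := by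
      rw [div_le_iff₀ hPx]
      linarith
    linarith
  -- The threshold exceeds by 1 the largest value `T M²` that `∫ u²` can have.
  obtain ⟨δ', hδ', hN⟩ := eventually_le_of_deriv_ge_div (f := fun x => -∫ t in 0..T, u t x ^ 2)
    (b := δ) hδ.1 (show 0 < 2 / K by positivity)
    (fun x hx => (h.hasDerivAt_integral_sq hT (hsubδ x hx)).neg) hlow' (-(T * M ^ 2) - 1)
  have hx : δ' / 2 ∈ Ioo 0 δ' := ⟨by linarith [hδ'.1], by linarith [hδ'.1]⟩
  have hx' : δ' / 2 ∈ Ioc 0 B :=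
    Ioo_subset_Ioc_self (hsubδ _ ⟨hx.1, hx.2.trans hδ'.2⟩)
  have h1 := hN _ hx
  have h2 : ∫ t in 0..T, u t (δ' / 2) ^ 2 ≤ ∫ t in 0..T, M ^ 2 := by
    have c1 := continuousOn_fst_slice (T := T) h.contu hx'
    exact intervalIntegral.integral_mono_on hT
      (ContinuousOn.intervalIntegrable_of_Icc hT (by fun_prop)) intervalIntegrable_const
      (fun t ht => (hsq t ht _ hx').2)
  rw [intervalIntegral.integral_const, smul_eq_mul] at h2
  linarith

theorem density_nonneg (h : IsDegenerateWave B K κ P W u p q pt px) {t x : ℝ} (hx : x ∈ Ioc 0 B) :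
    0 ≤ density κ P W u p q t x := by
  have h1 := h.κ_nonneg x hx
  have h2 := (h.P_pos x hx).le
  have h3 := h.W_nonneg x hx
  unfold density
  positivity

theorem continuousOn_density (h : IsDegenerateWave B K κ P W u p q pt px) {t : ℝ} (ht : 0 ≤ t) :
    ContinuousOn (density κ P W u p q t) (Ioc 0 B) := by
  have c1 := continuousOn_snd_slice h.contu ht
  have c2 := continuousOn_snd_slice h.contp ht
  have c3 := continuousOn_snd_slice h.contq ht
  have c6 := h.contκ
  have c7 := h.contP
  have c8 := h.contW
  unfold density
  fun_prop

/-- Continuity up to `x = B`, where `hasDerivAt_flux` does not apply, allows the fundamental theorem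
of calculus on `[x, B]`. -/
theorem continuousOn_flux (h : IsDegenerateWave B K κ P W u p q pt px) {T : ℝ} (hT : 0 ≤ T) :
    ContinuousOn (flux P p q T) (Ioc 0 B) := by
  intro x hx
  have c : ContinuousOn (Function.uncurry fun t x => P x * q t x * p t x) (Ici 0 ×ˢ Ioc 0 B) :=
    ((continuousOn_coeff h.contP).mul h.contq).mul h.contp
  have hsub : Icc (0 : ℝ) T ×ˢ Icc (x / 2) B ⊆ Ici 0 ×ˢ Ioc 0 B :=
    prod_mono (fun t ht => ht.1) (fun y hy => ⟨by linarith [hx.1, hy.1], hy.2⟩)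
  obtain ⟨C, hC⟩ := (isCompact_Icc.prod isCompact_Icc).exists_bound_of_continuousOn (c.mono hsub)
  have hIoc : Set.uIoc 0 T = Ioc 0 T := uIoc_of_le hT
  have hev : ∀ᶠ y in 𝓝[Ioc 0 B] x, y ∈ Icc (x / 2) B := by
    filter_upwards [self_mem_nhdsWithin,
      mem_nhdsWithin_of_mem_nhds (Ioi_mem_nhds (show x / 2 < x by linarith [hx.1]))] with y hy hy'
    exact ⟨le_of_lt hy', hy.2⟩
  refine intervalIntegral.continuousWithinAt_of_dominated_interval (bound := fun _ => C) ?_ ?_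
    intervalIntegrable_const ?_
  · filter_upwards [self_mem_nhdsWithin] with y hy
    rw [hIoc]
    have c2 := continuousOn_fst_slice (T := T) h.contp hy
    have c3 := continuousOn_fst_slice (T := T) h.contq hy
    refine ContinuousOn.aestronglyMeasurable ?_ measurableSet_Ioc
    exact ContinuousOn.mono (by fun_prop) (Ioc_subset_Icc_self)
  · filter_upwards [hev] with y hy
    refine Eventually.of_forall fun t ht => ?_
    rw [hIoc] at ht
    exact hC (t, y) ⟨Ioc_subset_Icc_self ht, hy⟩
  · refine Eventually.of_forall fun t ht => ?_
    rw [hIoc] at ht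
    exact (c.comp (f := fun y => (t, y)) (by fun_prop) (fun y hy => ⟨ht.1.le, hy⟩)) x hx

/-- Under the Robin condition the flux integrand `-c u p` is the exact time derivative of `-c u² /
2`. -/
theorem flux_boundary (h : IsDegenerateWave B K κ P W u p q pt px) {T c : ℝ} (hT : 0 ≤ T)
    (hbd : ∀ t, 0 ≤ t → P B * q t B = -(c * u t B)) :
    flux P p q T B = c * u 0 B ^ 2 / 2 - c * u T B ^ 2 / 2 := by
  have hB : B ∈ Ioc 0 B := ⟨h.B_pos, le_rfl⟩
  have c1 := continuousOn_fst_slice (T := T) h.contu hB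
  have c2 := continuousOn_fst_slice (T := T) h.contp hB
  have hderiv : ∀ t ∈ Icc 0 T, HasDerivWithinAt (fun t => -(c * u t B ^ 2 / 2))
      (-(c * u t B) * p t B) (Ici 0) t := fun t ht => by
    refine ((((h.u_t t ht.1 B hB).pow 2).const_mul c).div_const 2).neg.congr_deriv ?_
    push_cast
    ring
  have e : flux P p q T B = ∫ t in 0..T, -(c * u t B) * p t B := by
    refine intervalIntegral.integral_congr fun t ht => ?_
    rw [uIcc_of_le hT] at ht
    simp only [hbd t ht.1]
  rw [e, intervalIntegral.integral_eq_sub_of_hasDerivAt_of_le hT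
    (fun t ht => ((hderiv t ht).mono Icc_subset_Ici_self).continuousWithinAt)
    (fun t ht => (hderiv t (Ioo_subset_Icc_self ht)).hasDerivAt (Ici_mem_nhds ht.1))
    (ContinuousOn.intervalIntegrable_of_Icc hT (by fun_prop))]
  ring

theorem integral_density_sub (h : IsDegenerateWave B K κ P W u p q pt px) {T x : ℝ} (hT : 0 ≤ T)
    (hx : x ∈ Ioo 0 B) :
    (∫ y in x..B, density κ P W u p q T y) - ∫ y in x..B, density κ P W u p q 0 y
      = 2 * (flux P p q T B - flux P p q T x) := by
  have hsub : Icc x B ⊆ Ioc 0 B := fun y hy => ⟨hx.1.trans_le hy.1, hy.2⟩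
  have c1 := (h.continuousOn_density hT).mono hsub
  have c2 := (h.continuousOn_density le_rfl).mono hsub
  rw [← intervalIntegral.integral_eq_sub_of_hasDerivAt_of_le hx.2.le
    ((h.continuousOn_flux hT).mono hsub)
    (fun y hy => h.hasDerivAt_flux hT ⟨hx.1.trans hy.1, hy.2⟩)
    (ContinuousOn.intervalIntegrable_of_Icc hx.2.le (by fun_prop)),
    ← intervalIntegral.integral_sub (ContinuousOn.intervalIntegrable_of_Icc hx.2.le c1)
      (ContinuousOn.intervalIntegrable_of_Icc hx.2.le c2), ← intervalIntegral.integral_const_mul]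
  congr 1
  ext y
  ring

theorem ofReal_integral_density (h : IsDegenerateWave B K κ P W u p q pt px) {t x : ℝ}
    (ht : 0 ≤ t) (hx : x ∈ Ioo 0 B) :
    ENNReal.ofReal (∫ y in x..B, density κ P W u p q t y)
      = ∫⁻ y in Ioc x B, ENNReal.ofReal (density κ P W u p q t y) := by
  have hsub : Icc x B ⊆ Ioc 0 B := fun y hy => ⟨hx.1.trans_le hy.1, hy.2⟩
  rw [intervalIntegral.integral_of_le hx.2.le, ofReal_integral_eq_lintegral_ofReal]
  · exact (((h.continuousOn_density ht).mono hsub).integrableOn_Icc).mono_set Ioc_subset_Icc_self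
  · exact (ae_restrict_iff' measurableSet_Ioc).2 (Eventually.of_forall fun y hy =>
      h.density_nonneg ⟨hx.1.trans hy.1, hy.2⟩)

/-- The energy balance holds on `[x, B]`, where everything is finite. Points `x` of almost no flux
exist arbitrarily close to 0, and monotone convergence then covers all of `(0, B]`, even if the
energy is infinite. -/
theorem lintegral_density_le (h : IsDegenerateWave B K κ P W u p q pt px) {T c : ℝ} (hT : 0 ≤ T)
    (hc : 0 ≤ c) (hbd : ∀ t, 0 ≤ t → P B * q t B = -(c * u t B)) :
    ∫⁻ x in Ioc 0 B, ENNReal.ofReal (density κ P W u p q T x)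
      ≤ (∫⁻ x in Ioc 0 B, ENNReal.ofReal (density κ P W u p q 0 x))
        + ENNReal.ofReal (c * u 0 B ^ 2) := by
  have hB := h.B_pos
  have hpart : ∀ y ∈ Ioo 0 B, ∫⁻ x in Ioc y B, ENNReal.ofReal (density κ P W u p q T x)
      ≤ (∫⁻ x in Ioc 0 B, ENNReal.ofReal (density κ P W u p q 0 x))
        + ENNReal.ofReal (c * u 0 B ^ 2) := by
    intro y hy
    refine ENNReal.le_of_forall_pos_le_add fun ε hε _ => ?_
    -- The flux enters the energy balance with a factor 2, hence `ε / 2`.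
    obtain ⟨x, hx, hxε⟩ := h.exists_abs_flux_lt hT (c := ε / 2) (by positivity) hy.1
    have hx' : x ∈ Ioo 0 B := ⟨hx.1, hx.2.trans hy.2⟩
    have h1 := h.integral_density_sub hT hx'
    rw [h.flux_boundary hT hbd] at h1
    have h2 := neg_abs_le (flux P p q T x)
    have h3 : 0 ≤ c * u T B ^ 2 := by positivity
    calc ∫⁻ x in Ioc y B, ENNReal.ofReal (density κ P W u p q T x)
        ≤ ∫⁻ x in Ioc x B, ENNReal.ofReal (density κ P W u p q T x) :=
          lintegral_mono_set (Ioc_subset_Ioc_left hx.2.le)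
      _ = ENNReal.ofReal (∫ y in x..B, density κ P W u p q T y) :=
          (h.ofReal_integral_density hT hx').symm
      _ ≤ ENNReal.ofReal ((∫ y in x..B, density κ P W u p q 0 y) + c * u 0 B ^ 2 + ε) :=
          ENNReal.ofReal_le_ofReal (by linarith)
      _ ≤ ENNReal.ofReal (∫ y in x..B, density κ P W u p q 0 y) + ENNReal.ofReal (c * u 0 B ^ 2)
          + ENNReal.ofReal ε :=
          ENNReal.ofReal_add_le.trans (by gcongr; exact ENNReal.ofReal_add_le)
      _ ≤ _ := by
          rw [h.ofReal_integral_density le_rfl hx', ENNReal.ofReal_coe_nnreal]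
          gcongr
          exact hx.1.le
  -- The shift by 2 keeps the left endpoints strictly below `B`, including at `n = 0`.
  have hU : Ioc 0 B = ⋃ n : ℕ, Ioc (B / (n + 2)) B := by
    ext x
    simp only [mem_iUnion, mem_Ioc]
    constructor
    · rintro ⟨h1, h2⟩
      obtain ⟨n, hn⟩ := exists_nat_gt (B / x)
      refine ⟨n, ?_, h2⟩
      rw [div_lt_iff₀ h1] at hn
      rw [div_lt_iff₀ (by positivity)]
      nlinarith
    · rintro ⟨n, h1, h2⟩
      exact ⟨lt_trans (by positivity) h1, h2⟩
  have hmono : Monotone fun n : ℕ => Ioc (B / (n + 2)) B := by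
    intro m n hmn
    refine Ioc_subset_Ioc_left ?_
    gcongr
  rw [hU, setLIntegral_iUnion_of_directed _ hmono.directed_le, ← hU]
  refine iSup_le fun n => hpart _ ⟨by positivity, ?_⟩
  rw [div_lt_iff₀ (by positivity)]
  have : (0 : ℝ) ≤ n := n.cast_nonneg
  nlinarith

end IsDegenerateWave

/-! ### Derivatives and a priori bounds for the static star -/

namespace HardStar

variable (S : HardStar)

/-- The metric coefficient `1 - 2m/r`. -/
noncomputable def lapse (χ : ℝ) : ℝ := 1 - 2 * S.m χ / S.r χ

/-- The derivative of the area radius. -/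
noncomputable def rSlope (χ : ℝ) : ℝ := √(S.lapse χ) / (4 * Real.pi * S.r χ ^ 2 * √(2 * S.ρ χ - 1))

/-- The quotient of the derivatives of `1 - 2m/r` and `r`. -/
noncomputable def lapseSlope (χ : ℝ) : ℝ := -8 * Real.pi * S.r χ * S.ρ χ + 2 * S.m χ / S.r χ ^ 2

/-- The quotient of the derivatives of `m/r² + 4π r (ρ - 1)` and `r`. -/
noncomputable def forceSlope (χ : ℝ) : ℝ :=
  4 * Real.pi * S.ρ χ - 2 * S.m χ / S.r χ ^ 3 + 4 * Real.pi * (S.ρ χ - 1)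
    - 4 * Real.pi * S.r χ * ((2 * S.ρ χ - 1) / S.lapse χ * S.force χ)

/-- The coefficient of `∂_φ² r₁` in the divergence form of the master wave equation. -/
noncomputable def inertia (χ : ℝ) : ℝ := (2 * S.ρ χ - 1) / S.lapse χ

/-- The coefficient of `∂_χ r₁` in the divergence form of the master wave equation. -/
noncomputable def stiffness (χ : ℝ) : ℝ := 16 * Real.pi ^ 2 * S.r χ ^ 4 * S.inertia χ

/-- The zeroth order coefficient of the master wave equation, after expansion of all derivatives. -/
noncomputable def zerothOrder (χ : ℝ) : ℝ :=
  2 * (S.force χ / S.lapse χ) * S.force χ + 2 * (S.m χ / S.r χ ^ 3)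
    + 4 * Real.pi * S.r χ * (2 * S.ρ χ - 1) * (2 / S.r χ - S.force χ / S.lapse χ)
    + S.lapse χ * (-2 / S.r χ ^ 2
      - (S.forceSlope χ * S.lapse χ - S.force χ * S.lapseSlope χ) / S.lapse χ ^ 2)

/-- The potential in the divergence form of the master wave equation. -/
noncomputable def potential (χ : ℝ) : ℝ := -S.zerothOrder χ / S.lapse χ

variable {S} {χ : ℝ}

theorem lapse_pos (hχ : χ ∈ Ioc 0 S.B) : 0 < S.lapse χ := by
  have := S.r_pos χ hχ
  have h2 := S.two_m_lt_r χ hχ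
  rw [lapse, sub_pos, div_lt_one this]
  exact h2

theorem two_mul_ρ_sub_one_pos (hχ : χ ∈ Icc 0 S.B) : 0 < 2 * S.ρ χ - 1 := by
  have := S.one_le_ρ χ hχ
  linarith

theorem rSlope_pos (hχ : χ ∈ Ioc 0 S.B) : 0 < S.rSlope χ := by
  have h1 := S.r_pos χ hχ
  have h2 := Real.sqrt_pos.2 (lapse_pos hχ)
  have h3 := Real.sqrt_pos.2 (two_mul_ρ_sub_one_pos (Ioc_subset_Icc_self hχ))
  have := Real.pi_pos
  unfold rSlope
  positivity

theorem uniqueDiffWithinAt (hχ : χ ∈ Icc 0 S.B) : UniqueDiffWithinAt ℝ (Icc 0 S.B) χ :=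
  uniqueDiffOn_Icc S.B_pos χ hχ

theorem dChi_eq {f : ℝ → ℝ} {f' : ℝ} (hχ : χ ∈ Ioc 0 S.B)
    (h : HasDerivWithinAt f f' (Icc 0 S.B) χ) : S.dChi f χ = f' :=
  h.derivWithin (uniqueDiffWithinAt (Ioc_subset_Icc_self hχ))

theorem hasDerivWithinAt_r (hχ : χ ∈ Ioc 0 S.B) :
    HasDerivWithinAt S.r (S.rSlope χ) (Icc 0 S.B) χ := S.hasDeriv_r χ hχ

theorem dChi_r (hχ : χ ∈ Ioc 0 S.B) : S.dChi S.r χ = S.rSlope χ :=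
  dChi_eq hχ (hasDerivWithinAt_r hχ)

theorem hasDerivWithinAt_m (hχ : χ ∈ Ioc 0 S.B) :
    HasDerivWithinAt S.m (4 * Real.pi * S.r χ ^ 2 * S.ρ χ * S.rSlope χ) (Icc 0 S.B) χ := by
  rw [← dChi_r hχ]
  exact S.hasDeriv_m χ hχ

theorem hasDerivWithinAt_ρ (hχ : χ ∈ Ioc 0 S.B) :
    HasDerivWithinAt S.ρ (-((2 * S.ρ χ - 1) / S.lapse χ) * S.force χ * S.rSlope χ)
      (Icc 0 S.B) χ := by
  rw [← dChi_r hχ]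
  exact S.hasDeriv_ρ χ hχ

theorem hasDerivWithinAt_psi (hχ : χ ∈ Ioc 0 S.B) :
    HasDerivWithinAt S.psi (S.force χ / S.lapse χ * S.rSlope χ) (Icc 0 S.B) χ := by
  have h1 := two_mul_ρ_sub_one_pos (Ioc_subset_Icc_self hχ)
  have h2 := lapse_pos hχ
  refine (((((hasDerivWithinAt_ρ hχ).const_mul 2).sub_const 1).log h1.ne').const_mul
    (-(1 / 2))).congr_deriv ?_
  field_simp

theorem dChi_psi (hχ : χ ∈ Ioc 0 S.B) : S.dChi S.psi χ = S.force χ / S.lapse χ * S.rSlope χ :=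
  dChi_eq hχ (hasDerivWithinAt_psi hχ)

theorem psiSlope_eq (hχ : χ ∈ Ioc 0 S.B) : S.psiSlope χ = S.force χ / S.lapse χ := by
  have := rSlope_pos hχ
  rw [psiSlope, dChi_psi hχ, dChi_r hχ]
  field_simp

theorem hasDerivWithinAt_lapse (hχ : χ ∈ Ioc 0 S.B) :
    HasDerivWithinAt S.lapse (S.lapseSlope χ * S.rSlope χ) (Icc 0 S.B) χ := by
  have h1 := S.r_pos χ hχ
  refine ((((hasDerivWithinAt_m hχ).const_mul 2).div (hasDerivWithinAt_r hχ) h1.ne').const_sub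
    1).congr_deriv ?_
  unfold lapseSlope
  field_simp
  ring

theorem hasDerivWithinAt_force (hχ : χ ∈ Ioc 0 S.B) :
    HasDerivWithinAt S.force (S.forceSlope χ * S.rSlope χ) (Icc 0 S.B) χ := by
  have h1 := S.r_pos χ hχ
  refine (((hasDerivWithinAt_m hχ).div ((hasDerivWithinAt_r hχ).pow 2)
    (pow_pos h1 2).ne').add
    (((hasDerivWithinAt_r hχ).const_mul (4 * Real.pi)).mul
      ((hasDerivWithinAt_ρ hχ).sub_const 1))).congr_deriv ?_
  unfold forceSlope
  simp only [Pi.pow_apply]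
  push_cast
  field_simp
  ring

/-- The bracket supplies exactly the first-order coefficients of the master equation, which is what
makes the divergence form possible. -/
theorem hasDerivWithinAt_rSlope (hχ : χ ∈ Ioc 0 S.B) :
    HasDerivWithinAt S.rSlope (S.rSlope χ ^ 2 *
      (S.lapseSlope χ / (2 * S.lapse χ) - 2 / S.r χ + S.force χ / S.lapse χ)) (Icc 0 S.B) χ := by
  have h1 := S.r_pos χ hχ
  have h2 := two_mul_ρ_sub_one_pos (Ioc_subset_Icc_self hχ)
  have h3 := lapse_pos hχ
  have hs := Real.sqrt_pos.2 h3
  have ht := Real.sqrt_pos.2 h2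
  have hs2 := Real.sq_sqrt h3.le
  have ht2 := Real.sq_sqrt h2.le
  have hpi := Real.pi_pos
  refine (((hasDerivWithinAt_lapse hχ).sqrt h3.ne').div
    ((((hasDerivWithinAt_r hχ).pow 2).const_mul (4 * Real.pi)).mul
      ((((hasDerivWithinAt_ρ hχ).const_mul 2).sub_const 1).sqrt h2.ne'))
      (by simp only [Pi.mul_apply, Pi.pow_apply]; positivity)).congr_deriv ?_
  unfold rSlope
  simp only [Pi.mul_apply, Pi.pow_apply]
  push_cast
  generalize √(S.lapse χ) = s at *
  generalize √(2 * S.ρ χ - 1) = t at *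
  rw [← hs2, ← ht2]
  field_simp
  ring

theorem rSlope_sq_mul_stiffness (hχ : χ ∈ Ioc 0 S.B) : S.rSlope χ ^ 2 * S.stiffness χ = 1 := by
  have h1 := S.r_pos χ hχ
  have h2 := two_mul_ρ_sub_one_pos (Ioc_subset_Icc_self hχ)
  have h3 := lapse_pos hχ
  have hpi := Real.pi_pos
  rw [rSlope, stiffness, inertia, div_pow, mul_pow, Real.sq_sqrt h3.le, Real.sq_sqrt h2.le]
  field_simp
  norm_num

/-- At the center, where the slope of `r` is infinite, continuity alone suffices. -/
theorem monotoneOn_of_hasDerivWithinAt {f f' : ℝ → ℝ} (hc : ContinuousOn f (Icc 0 S.B))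
    (hd : ∀ χ ∈ Ioc 0 S.B, HasDerivWithinAt f (f' χ) (Icc 0 S.B) χ)
    (hf' : ∀ χ ∈ Ioc 0 S.B, 0 ≤ f' χ) : MonotoneOn f (Icc 0 S.B) := by
  have hd' : ∀ χ ∈ Ioo 0 S.B, HasDerivAt f (f' χ) χ := fun χ hχ =>
    (hd χ (Ioo_subset_Ioc_self hχ)).hasDerivAt (Icc_mem_nhds hχ.1 hχ.2)
  refine monotoneOn_of_deriv_nonneg (convex_Icc 0 S.B) hc ?_ ?_
  · rw [interior_Icc]
    exact fun x hx => (hd' x hx).differentiableAt.differentiableWithinAt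
  · rw [interior_Icc]
    intro x hx
    rw [(hd' x hx).deriv]
    exact hf' x (Ioo_subset_Ioc_self hx)

theorem zero_mem : (0 : ℝ) ∈ Icc 0 S.B := ⟨le_rfl, S.B_pos.le⟩

theorem B_mem : S.B ∈ Ioc 0 S.B := ⟨S.B_pos, le_rfl⟩

theorem r_nonneg (hχ : χ ∈ Icc 0 S.B) : 0 ≤ S.r χ := by
  rcases hχ.1.eq_or_lt with h | h
  · rw [← h, S.r_zero]
  · exact (S.r_pos χ ⟨h, hχ.2⟩).le

theorem r_le_radius (hχ : χ ∈ Icc 0 S.B) : S.r χ ≤ S.radius :=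
  monotoneOn_of_hasDerivWithinAt S.continuousOn_r (fun _ h => hasDerivWithinAt_r h)
    (fun _ h => (rSlope_pos h).le) hχ (Ioc_subset_Icc_self B_mem) hχ.2

/-- Because `ρ ≥ 1`, the difference of the two sides is monotone, and it vanishes at the center.
This makes the force positive, so that `ρ` is largest at the center, which in turn gives the upper
bound `m_le`. -/
theorem le_m (hχ : χ ∈ Icc 0 S.B) : 4 * Real.pi / 3 * S.r χ ^ 3 ≤ S.m χ := by
  have c1 := S.continuousOn_r
  have c2 := S.continuousOn_m
  have := monotoneOn_of_hasDerivWithinAt (S := S) (f := fun χ => S.m χ - 4 * Real.pi / 3 * S.r χ ^ 3)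
    (by fun_prop) (fun χ h => (hasDerivWithinAt_m h).sub
      (((hasDerivWithinAt_r h).pow 3).const_mul (4 * Real.pi / 3))) (fun χ h => ?_)
      zero_mem hχ hχ.1
  · simp only [S.m_zero, S.r_zero] at this
    linarith
  · have h1 := S.one_le_ρ χ (Ioc_subset_Icc_self h)
    have h2 := rSlope_pos h
    have h3 := Real.pi_pos
    have : 0 ≤ 4 * Real.pi * S.r χ ^ 2 * S.rSlope χ * (S.ρ χ - 1) := by
      have : 0 ≤ S.ρ χ - 1 := by linarith
      positivity
    push_cast
    linarith

theorem m_nonneg (hχ : χ ∈ Icc 0 S.B) : 0 ≤ S.m χ := by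
  have := r_nonneg hχ
  have := Real.pi_pos
  exact le_trans (by positivity) (le_m hχ)

theorem force_pos (hχ : χ ∈ Ioc 0 S.B) : 0 < S.force χ := by
  have h1 := S.r_pos χ hχ
  have h2 := le_m (Ioc_subset_Icc_self hχ)
  have h3 := Real.pi_pos
  have h4 := S.one_le_ρ χ (Ioc_subset_Icc_self hχ)
  have h5 : 0 < S.m χ := lt_of_lt_of_le (by positivity) h2
  have h6 : 0 ≤ S.ρ χ - 1 := by linarith
  unfold force
  positivity

theorem ρ_le (hχ : χ ∈ Icc 0 S.B) : S.ρ χ ≤ S.ρ 0 := by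
  have := monotoneOn_of_hasDerivWithinAt (S := S) S.continuousOn_ρ.neg
    (fun χ h => (hasDerivWithinAt_ρ h).neg) (fun χ h => ?_) zero_mem hχ hχ.1
  · simp only [Pi.neg_apply] at this
    linarith
  · have h1 := two_mul_ρ_sub_one_pos (Ioc_subset_Icc_self h)
    have h2 := lapse_pos h
    have h3 := force_pos h
    have h4 := rSlope_pos h
    have : 0 ≤ (2 * S.ρ χ - 1) / S.lapse χ * S.force χ * S.rSlope χ := by positivity
    linarith

theorem m_le (hχ : χ ∈ Icc 0 S.B) : S.m χ ≤ 4 * Real.pi / 3 * S.ρ 0 * S.r χ ^ 3 := by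
  have c1 := S.continuousOn_r
  have c2 := S.continuousOn_m
  have := monotoneOn_of_hasDerivWithinAt (S := S)
    (f := fun χ => 4 * Real.pi / 3 * S.ρ 0 * S.r χ ^ 3 - S.m χ)
    (by fun_prop) (fun χ h => (((hasDerivWithinAt_r h).pow 3).const_mul
      (4 * Real.pi / 3 * S.ρ 0)).sub (hasDerivWithinAt_m h)) (fun χ h => ?_)
      zero_mem hχ hχ.1
  · simp only [S.m_zero, S.r_zero] at this
    linarith
  · have h1 := ρ_le (Ioc_subset_Icc_self h)
    have h2 := rSlope_pos h
    have h3 := Real.pi_pos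
    have : 0 ≤ 4 * Real.pi * S.r χ ^ 2 * S.rSlope χ * (S.ρ 0 - S.ρ χ) := by
      have : 0 ≤ S.ρ 0 - S.ρ χ := by linarith
      positivity
    push_cast
    linarith

theorem lapse_le_one (hχ : χ ∈ Ioc 0 S.B) : S.lapse χ ≤ 1 := by
  have := m_nonneg (Ioc_subset_Icc_self hχ)
  have := S.r_pos χ hχ
  have : 0 ≤ 2 * S.m χ / S.r χ := by positivity
  unfold lapse
  linarith

/-- The slope of `r³` is `3 √a / (4π √(2ρ - 1)) ≤ 1`. The bound converts `P ≲ r⁴` into `P ≤ K χ`,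
the degeneracy needed at the center. -/
theorem r_pow_three_le (hχ : χ ∈ Icc 0 S.B) : S.r χ ^ 3 ≤ χ := by
  have c1 := S.continuousOn_r
  have := monotoneOn_of_hasDerivWithinAt (S := S) (f := fun χ => χ - S.r χ ^ 3)
    (by fun_prop) (fun χ h => (hasDerivWithinAt_id χ _).sub
      ((hasDerivWithinAt_r h).pow 3)) (fun χ h => ?_) zero_mem hχ hχ.1
  · simp only [S.r_zero] at this
    linarith
  · have h1 := S.r_pos χ h
    have h2 := S.one_le_ρ χ (Ioc_subset_Icc_self h)
    have h3 := Real.pi_gt_three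
    have hs : √(S.lapse χ) ≤ 1 := Real.sqrt_le_one.2 (lapse_le_one h)
    have ht : 1 ≤ √(2 * S.ρ χ - 1) := Real.one_le_sqrt.2 (by linarith)
    have hs0 := Real.sqrt_nonneg (S.lapse χ)
    have e : (3 : ℕ) * S.r χ ^ (3 - 1) * S.rSlope χ
        = 3 * √(S.lapse χ) / (4 * Real.pi * √(2 * S.ρ χ - 1)) := by
      unfold rSlope
      push_cast
      field_simp
    rw [e, sub_nonneg, div_le_one (by positivity)]
    nlinarith

end HardStar

/-! ### Divergence form of the master equation and size of its coefficients -/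

namespace HardStar

variable {S : HardStar} {χ : ℝ}

theorem dChi_congr {f g : ℝ → ℝ} (hχ : χ ∈ Ioc 0 S.B) (h : EqOn f g (Ioc 0 S.B)) :
    S.dChi f χ = S.dChi g χ := by
  refine Filter.EventuallyEq.derivWithin_eq ?_ (h hχ)
  filter_upwards [self_mem_nhdsWithin, mem_nhdsWithin_of_mem_nhds (Ioi_mem_nhds hχ.1)] with x hx hx'
  exact h ⟨hx', hx.2⟩

/-- With `P = g⁻²`, differentiating `(q/g)/g` gives `g⁻¹ ∂_χ(q/g)` and a multiple of `q g'/g³`; the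
latter equals the first-order terms of the master equation divided by the lapse. -/
theorem hasDerivAt_stiffness_mul_dChi {u : ℝ → ℝ → ℝ} {φ q' : ℝ} (hχ : χ ∈ Ioo 0 S.B)
    (heq : S.MasterEquationAt u φ χ) (hu : HasDerivAt (u φ) (S.dChi (u φ) χ) χ)
    (hq : HasDerivAt (fun x => S.dChi (u φ) x) q' χ) :
    HasDerivAt (fun x => S.stiffness x * S.dChi (u φ) x)
      (S.inertia χ * dPhi (dPhi u) φ χ + S.potential χ * u φ χ) χ := by
  have hχ' : χ ∈ Ioc 0 S.B := Ioo_subset_Ioc_self hχ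
  have hr := S.r_pos χ hχ'
  have ha := lapse_pos hχ'
  have hF := force_pos hχ'
  have hg := rSlope_pos hχ'
  have hmem : Icc 0 S.B ∈ 𝓝 χ := Icc_mem_nhds hχ.1 hχ.2
  have dg := (hasDerivWithinAt_rSlope hχ').hasDerivAt hmem
  have dr := (hasDerivWithinAt_r hχ').hasDerivAt hmem
  have dF := (hasDerivWithinAt_force hχ').hasDerivAt hmem
  have da := (hasDerivWithinAt_lapse hχ').hasDerivAt hmem
  have d1 := hq.div dg hg.ne'
  have d2 := (((hasDerivAt_const χ (2 : ℝ)).div dr hr.ne').sub (dF.div da ha.ne')).mul hu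
  have e1 : S.dChi (fun x => S.dChi (u φ) x / S.dChi S.r x) χ = _ :=
    (dChi_congr hχ' fun x hx => by simp only [dChi_r hx]; rfl).trans
      (dChi_eq hχ' d1.hasDerivWithinAt)
  have e2 : S.dChi (fun x => (2 / S.r x - S.psiSlope x) * u φ x) χ = _ :=
    (dChi_congr hχ' fun x hx => by simp only [psiSlope_eq hx]; rfl).trans
      (dChi_eq hχ' d2.hasDerivWithinAt)
  have hev : (fun x => S.stiffness x * S.dChi (u φ) x)
      =ᶠ[𝓝 χ] (fun x => S.dChi (u φ) x) / S.rSlope / S.rSlope := by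
    filter_upwards [Ioo_mem_nhds hχ.1 hχ.2] with x hx
    have hx' : x ∈ Ioc 0 S.B := Ioo_subset_Ioc_self hx
    have h1 := rSlope_sq_mul_stiffness hx'
    have h2 := rSlope_pos hx'
    simp only [Pi.div_apply]
    field_simp
    linear_combination S.dChi (u φ) x * h1
  refine ((d1.div dg hg.ne').congr_of_eventuallyEq hev).congr_deriv ?_
  unfold MasterEquationAt at heq
  rw [e1, e2, dChi_psi hχ', psiSlope_eq hχ', dChi_r hχ'] at heq
  simp only [Pi.sub_apply, Pi.div_apply] at heq ⊢
  have hA : S.lapseSlope χ = -2 * (4 * Real.pi * S.r χ * S.ρ χ - S.m χ / S.r χ ^ 2) := by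
    unfold lapseSlope
    ring
  have hI : S.inertia χ * dPhi (dPhi u) φ χ
      = ((2 * S.ρ χ - 1) * dPhi (dPhi u) φ χ) / S.lapse χ := by
    unfold inertia
    ring
  rw [hI, sub_eq_iff_eq_add.1 heq]
  unfold potential zerothOrder
  rw [hA]
  generalize 4 * Real.pi * S.r χ * S.ρ χ - S.m χ / S.r χ ^ 2 = A
  generalize S.dChi (u φ) χ = q
  generalize S.force χ = F at *
  generalize S.forceSlope χ = F1
  generalize S.rSlope χ = g at *
  generalize S.lapse χ = a at *
  generalize S.r χ = r at *
  generalize S.m χ / r ^ 3 = m3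
  generalize Real.pi = π
  field_simp
  ring

/-- This is the remainder of `r²` times the zeroth-order coefficient after its leading part `-2`,
with `α = m/r³`, `s = F/a` and `i` the inertia. The bracket is crudely at most 100, and `r² ≤
1/10000`. -/
theorem abs_lower_order_le {r ρ π α F s i : ℝ} (hr : 0 < r ∧ r ≤ 1 / 100)
    (hρ : 1 ≤ ρ ∧ ρ ≤ 101 / 100) (hπ : 3 < π ∧ π < 3.15) (hα : 0 ≤ α ∧ α ≤ 43 / 10)
    (hF : 0 < F ∧ F ≤ 1 / 20) (hs : 0 < s ∧ s ≤ 1 / 10) (hi : 1 ≤ i ∧ i ≤ 2) :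
    |r ^ 2 * (2 * F * s + 6 * α + 8 * π * (2 * ρ - 1) - 4 * π * r * (2 * ρ - 1) * s
      - (4 * π * ρ - 2 * α + 4 * π * (ρ - 1) - 4 * π * r * (i * F))
      + s * (-8 * π * r * ρ + 2 * α * r))| ≤ 1 / 100 := by
  obtain ⟨hr0, hr1⟩ := hr
  obtain ⟨hρ1, hρ2⟩ := hρ
  obtain ⟨hπ1, hπ2⟩ := hπ
  obtain ⟨hα0, hα1⟩ := hα
  obtain ⟨hF0, hF1⟩ := hF
  obtain ⟨hs0, hs1⟩ := hs
  obtain ⟨hi1, hi2⟩ := hi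
  have hπ3 : π ≤ 315 / 100 := by norm_num at hπ2 ⊢; linarith
  have hi0 : 0 < i := by linarith
  have hπ0 : 0 < π := by linarith
  have hρ0 : 0 < ρ := by linarith
  have hr2 : r ^ 2 ≤ 1 / 10000 := by nlinarith
  have hn : 0 < 2 * ρ - 1 := by linarith
  have hn2 : 2 * ρ - 1 ≤ 102 / 100 := by linarith
  have b1 : F * s ≤ 1 / 20 * (1 / 10) := by gcongr
  have b1' : 0 ≤ F * s := by positivity
  have b2 : π * (2 * ρ - 1) ≤ 315 / 100 * (102 / 100) := by gcongr
  have b2' : 0 ≤ π * (2 * ρ - 1) := by positivity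
  have b3 : π * (2 * ρ - 1) * (r * s) ≤ 315 / 100 * (102 / 100) * (1 / 100 * (1 / 10)) := by gcongr
  have b3' : 0 ≤ π * (2 * ρ - 1) * (r * s) := by positivity
  have b4 : π * ρ ≤ 315 / 100 * (101 / 100) := by gcongr
  have b4' : 0 ≤ π * ρ := by positivity
  have b5 : π * r * (i * F) ≤ 315 / 100 * (1 / 100) * (2 * (1 / 20)) := by gcongr
  have b5' : 0 ≤ π * r * (i * F) := by positivity
  have b6 : s * (r * α) ≤ 1 / 10 * (1 / 100 * (43 / 10)) := by gcongr
  have b6' : 0 ≤ s * (r * α) := by positivity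
  have b7 : π * ρ * (s * r) ≤ 315 / 100 * (101 / 100) * (1 / 10 * (1 / 100)) := by gcongr
  have b7' : 0 ≤ π * ρ * (s * r) := by positivity
  rw [abs_mul, abs_of_pos (by positivity)]
  calc r ^ 2 * _ ≤ 1 / 10000 * 100 := by
        gcongr
        rw [abs_le]
        constructor <;> linarith
    _ = _ := by norm_num

theorem coefficient_bounds (hrad : S.radius < 1 / 100) (hρ : S.ρ 0 < 1 + 1 / 100) (hχ : χ ∈ Ioc 0 S.B) :
    (99 / 100 ≤ S.lapse χ ∧ S.lapse χ ≤ 1) ∧ (1 ≤ S.inertia χ ∧ S.inertia χ ≤ 2) ∧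
    (S.force χ / S.lapse χ ≤ 1) ∧
    (1 / S.r χ ^ 2 ≤ S.potential χ ∧ S.potential χ ≤ 4 / S.r χ ^ 2) := by
  have hχ' := Ioc_subset_Icc_self hχ
  have hr := S.r_pos χ hχ
  have hr1 : S.r χ ≤ 1 / 100 := (r_le_radius hχ').trans hrad.le
  have hρ1 := S.one_le_ρ χ hχ'
  have hρ2 : S.ρ χ ≤ 101 / 100 := (ρ_le hχ').trans (by linarith)
  have hπ := Real.pi_gt_three
  have hπ2 := Real.pi_lt_d2
  have hF0 := force_pos hχ
  have hα0 : 0 ≤ S.m χ / S.r χ ^ 3 := by have := m_nonneg hχ'; positivity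
  -- The bound is a rounding up of `(4π/3) · 1.01`.
  have hα1 : S.m χ / S.r χ ^ 3 ≤ 43 / 10 := by
    rw [div_le_iff₀ (by positivity)]
    refine (m_le hχ').trans ?_
    gcongr
    have : S.ρ 0 ≤ 101 / 100 := by linarith
    have h0 : 0 ≤ S.ρ 0 := by have := ρ_le hχ'; linarith
    nlinarith
  have hF : S.force χ
      = S.m χ / S.r χ ^ 3 * S.r χ + 4 * Real.pi * S.r χ * (S.ρ χ - 1) := by
    unfold force
    field_simp
  have ha : S.lapse χ = 1 - 2 * (S.m χ / S.r χ ^ 3) * S.r χ ^ 2 := by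
    unfold lapse
    field_simp
  have hA : S.lapseSlope χ
      = -8 * Real.pi * S.r χ * S.ρ χ + 2 * (S.m χ / S.r χ ^ 3) * S.r χ := by
    unfold lapseSlope
    field_simp
  have hF1 : S.forceSlope χ = 4 * Real.pi * S.ρ χ - 2 * (S.m χ / S.r χ ^ 3)
      + 4 * Real.pi * (S.ρ χ - 1) - 4 * Real.pi * S.r χ * (S.inertia χ * S.force χ) := by
    unfold forceSlope inertia
    ring
  have hi : S.inertia χ * S.lapse χ = 2 * S.ρ χ - 1 :=
    div_mul_cancel₀ _ (lapse_pos hχ).ne'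
  -- Expanding `-2a/r²` with `a = 1 - 2m/r` isolates the singular part `-2/r²`; its correction
  -- `4m/r³` joins the explicit `2m/r³` to give the coefficient 6.
  have hV : S.zerothOrder χ * S.r χ ^ 2 = -2 + S.r χ ^ 2 *
      (2 * S.force χ * (S.force χ / S.lapse χ) + 6 * (S.m χ / S.r χ ^ 3)
      + 8 * Real.pi * (2 * S.ρ χ - 1)
      - 4 * Real.pi * S.r χ * (2 * S.ρ χ - 1) * (S.force χ / S.lapse χ)
      - S.forceSlope χ + S.force χ / S.lapse χ * S.lapseSlope χ) := by
    have h0 := lapse_pos hχ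
    have e : S.lapse χ * (-2 / S.r χ ^ 2
      - (S.forceSlope χ * S.lapse χ - S.force χ * S.lapseSlope χ) / S.lapse χ ^ 2)
      = -2 * S.lapse χ / S.r χ ^ 2 - S.forceSlope χ + S.force χ / S.lapse χ * S.lapseSlope χ := by
      field_simp
      ring
    unfold zerothOrder
    rw [e]
    have e2 : -2 * S.lapse χ / S.r χ ^ 2 = -2 / S.r χ ^ 2 + 4 * (S.m χ / S.r χ ^ 3) := by
      rw [ha]
      field_simp
      ring
    rw [e2]
    field_simp
    ring
  have hpot : S.potential χ = -(S.zerothOrder χ * S.r χ ^ 2) / S.lapse χ / S.r χ ^ 2 := by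
    unfold potential
    field_simp
  rw [hpot, div_le_div_iff_of_pos_right (by positivity),
    div_le_div_iff_of_pos_right (by positivity), hV]
  have ha0 := lapse_pos hχ
  have ha2 := lapse_le_one hχ
  have hr2 : S.r χ ^ 2 ≤ 1 / 10000 := by nlinarith
  have ha1 : 99 / 100 ≤ S.lapse χ := by nlinarith
  have hF2 : S.force χ ≤ 1 / 20 := by
    have h1 : S.m χ / S.r χ ^ 3 * S.r χ ≤ 43 / 10 * (1 / 100) := by gcongr
    have h2 : 4 * Real.pi * S.r χ * (S.ρ χ - 1) ≤ 4 * (315 / 100) * (1 / 100) * (1 / 100) := by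
      gcongr <;> linarith
    linarith
  have hi1 : 1 ≤ S.inertia χ := by nlinarith
  have hi2 : S.inertia χ ≤ 2 := by nlinarith
  have hs0 : 0 < S.force χ / S.lapse χ := by positivity
  have hs1 : S.force χ / S.lapse χ ≤ 1 / 10 := by
    rw [div_le_iff₀ ha0]
    linarith
  have hY := abs_lower_order_le ⟨hr, hr1⟩ ⟨hρ1, hρ2⟩ ⟨hπ, hπ2⟩ ⟨hα0, hα1⟩ ⟨hF0, hF2⟩
    ⟨hs0, hs1⟩ ⟨hi1, hi2⟩
  rw [hF1, hA]
  obtain ⟨hY1, hY2⟩ := abs_le.1 hY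
  refine ⟨⟨ha1, ha2⟩, ⟨hi1, hi2⟩, by linarith, ?_, ?_⟩
  · rw [le_div_iff₀ ha0]
    linarith
  · rw [div_le_iff₀ ha0]
    linarith

end HardStar

/-! ### Partial derivatives of a solution, and reduction to the degenerate wave equation -/

namespace HardStar

variable {S : HardStar} {χ : ℝ}

variable (S) in
/-- The domain of a solution, without the center. -/
def domain : Set (ℝ × ℝ) := Ici 0 ×ˢ Ioc 0 S.B

theorem uniqueDiffOn_domain : UniqueDiffOn ℝ S.domain :=
  (uniqueDiffOn_Ici 0).prod (uniqueDiffOn_Ioc 0 S.B)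

section Partials

variable {w : ℝ → ℝ → ℝ} {n : ℕ} {φ : ℝ}

theorem hasDerivWithinAt_fst (hw : ContDiffOn ℝ (n + 1) (Function.uncurry w) S.domain)
    (hz : (φ, χ) ∈ S.domain) :
    HasDerivWithinAt (fun s => w s χ)
      (fderivWithin ℝ (Function.uncurry w) S.domain (φ, χ) (1, 0)) (Ici 0) φ := by
  have h1 := ((hw.differentiableOn (by simp)) (φ, χ) hz).hasFDerivWithinAt
  exact h1.comp_hasDerivWithinAt (f := fun s => (s, χ)) φ
    ((hasDerivWithinAt_id φ _).prodMk (hasDerivWithinAt_const φ _ χ)) (fun s hs => ⟨hs, hz.2⟩)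

theorem hasDerivWithinAt_snd (hw : ContDiffOn ℝ (n + 1) (Function.uncurry w) S.domain)
    (hz : (φ, χ) ∈ S.domain) :
    HasDerivWithinAt (w φ)
      (fderivWithin ℝ (Function.uncurry w) S.domain (φ, χ) (0, 1)) (Icc 0 S.B) χ := by
  have h1 := ((hw.differentiableOn (by simp)) (φ, χ) hz).hasFDerivWithinAt
  have h2 : HasDerivWithinAt (w φ) (fderivWithin ℝ (Function.uncurry w) S.domain (φ, χ) (0, 1))
      (Ioc 0 S.B) χ :=
    h1.comp_hasDerivWithinAt (f := fun x => (φ, x)) χ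
      ((hasDerivWithinAt_const χ _ φ).prodMk (hasDerivWithinAt_id χ _)) (fun x hx => ⟨hz.1, hx⟩)
  refine h2.mono_of_mem_nhdsWithin ?_
  filter_upwards [self_mem_nhdsWithin, mem_nhdsWithin_of_mem_nhds (Ioi_mem_nhds hz.2.1)]
    with x hx hx'
  exact ⟨hx', hx.2⟩

theorem dPhi_eq_fderivWithin (hw : ContDiffOn ℝ (n + 1) (Function.uncurry w) S.domain) :
    EqOn (Function.uncurry (dPhi w))
      (fun z => fderivWithin ℝ (Function.uncurry w) S.domain z (1, 0)) S.domain :=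
  fun z hz => (hasDerivWithinAt_fst hw hz).derivWithin (uniqueDiffOn_Ici 0 z.1 hz.1)

theorem dChi_eq_fderivWithin (hw : ContDiffOn ℝ (n + 1) (Function.uncurry w) S.domain) :
    EqOn (Function.uncurry fun φ => S.dChi (w φ))
      (fun z => fderivWithin ℝ (Function.uncurry w) S.domain z (0, 1)) S.domain :=
  fun _ hz => dChi_eq hz.2 (hasDerivWithinAt_snd hw hz)

theorem contDiffOn_fderivWithin_apply
    (hw : ContDiffOn ℝ (n + 1) (Function.uncurry w) S.domain) (v : ℝ × ℝ) :
    ContDiffOn ℝ n (fun z => fderivWithin ℝ (Function.uncurry w) S.domain z v) S.domain :=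
  (hw.fderivWithin uniqueDiffOn_domain le_rfl).clm_apply contDiffOn_const

theorem contDiffOn_dPhi (hw : ContDiffOn ℝ (n + 1) (Function.uncurry w) S.domain) :
    ContDiffOn ℝ n (Function.uncurry (dPhi w)) S.domain :=
  (contDiffOn_fderivWithin_apply hw (1, 0)).congr (dPhi_eq_fderivWithin hw)

theorem contDiffOn_dChi (hw : ContDiffOn ℝ (n + 1) (Function.uncurry w) S.domain) :
    ContDiffOn ℝ n (Function.uncurry fun φ => S.dChi (w φ)) S.domain :=
  (contDiffOn_fderivWithin_apply hw (0, 1)).congr (dChi_eq_fderivWithin hw)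

theorem hasDerivWithinAt_dPhi (hw : ContDiffOn ℝ (n + 1) (Function.uncurry w) S.domain)
    (hz : (φ, χ) ∈ S.domain) : HasDerivWithinAt (fun s => w s χ) (dPhi w φ χ) (Ici 0) φ :=
  (hasDerivWithinAt_fst hw hz).congr_deriv (dPhi_eq_fderivWithin hw hz).symm

theorem hasDerivWithinAt_dChi (hw : ContDiffOn ℝ (n + 1) (Function.uncurry w) S.domain)
    (hz : (φ, χ) ∈ S.domain) : HasDerivWithinAt (w φ) (S.dChi (w φ) χ) (Icc 0 S.B) χ :=
  (hasDerivWithinAt_snd hw hz).congr_deriv (dChi_eq_fderivWithin hw hz).symm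

theorem hasDerivAt_dChi (hw : ContDiffOn ℝ (n + 1) (Function.uncurry w) S.domain)
    (hφ : 0 ≤ φ) (hχ : χ ∈ Ioo 0 S.B) : HasDerivAt (w φ) (S.dChi (w φ) χ) χ :=
  (hasDerivWithinAt_dChi hw ⟨hφ, Ioo_subset_Ioc_self hχ⟩).hasDerivAt (Icc_mem_nhds hχ.1 hχ.2)

theorem dPhi_dChi (hw : ContDiffOn ℝ 2 (Function.uncurry w) S.domain) (hz : (φ, χ) ∈ S.domain) :
    dPhi (fun φ => S.dChi (w φ)) φ χ = S.dChi (dPhi w φ) χ := by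
  have hw' : ContDiffOn ℝ ((1 : ℕ) + 1) (Function.uncurry w) S.domain := by
    norm_num
    exact hw
  have h1 : ContDiffOn ℝ ((0 : ℕ) + 1) (Function.uncurry (dPhi w)) S.domain := by
    simpa using contDiffOn_dPhi hw'
  have h2 : ContDiffOn ℝ ((0 : ℕ) + 1) (Function.uncurry fun φ => S.dChi (w φ)) S.domain := by
    simpa using contDiffOn_dChi hw'
  have hU := uniqueDiffOn_domain (S := S) (φ, χ) hz
  have hd : DifferentiableWithinAt ℝ (fderivWithin ℝ (Function.uncurry w) S.domain)
      S.domain (φ, χ) :=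
    ((hw'.fderivWithin uniqueDiffOn_domain le_rfl).differentiableOn (by simp)) _ hz
  have happly : ∀ v v' : ℝ × ℝ,
      fderivWithin ℝ (fun z => fderivWithin ℝ (Function.uncurry w) S.domain z v) S.domain (φ, χ) v'
      = fderivWithin ℝ (fderivWithin ℝ (Function.uncurry w) S.domain) S.domain (φ, χ) v' v := by
    intro v v'
    rw [fderivWithin_clm_apply hU hd (differentiableWithinAt_const v)]
    simp
  -- Second derivatives are symmetric also at boundary points, since the domain lies in the closure
  -- of its interior.
  have hsymm := (hw (φ, χ) hz).isSymmSndFDerivWithinAt (by simp) uniqueDiffOn_domain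
    (by
      have hB := S.B_pos
      rw [domain, interior_prod_eq, interior_Ici, interior_Ioc, closure_prod_eq, closure_Ioi,
        closure_Ioo hB.ne]
      exact ⟨hz.1, Ioc_subset_Icc_self hz.2⟩) hz
  have e1 := dPhi_eq_fderivWithin h2 hz
  have e2 := dChi_eq_fderivWithin h1 hz
  beta_reduce at e1 e2
  rw [fderivWithin_congr (dChi_eq_fderivWithin hw') (dChi_eq_fderivWithin hw' hz), happly] at e1
  rw [fderivWithin_congr (dPhi_eq_fderivWithin hw') (dPhi_eq_fderivWithin hw' hz), happly] at e2
  exact e1.trans ((hsymm (1, 0) (0, 1)).trans e2.symm)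

end Partials

theorem continuousOn_coefficients : ContinuousOn S.inertia (Ioc 0 S.B) ∧
    ContinuousOn S.stiffness (Ioc 0 S.B) ∧ ContinuousOn S.potential (Ioc 0 S.B) := by
  have c1 := S.continuousOn_r.mono Ioc_subset_Icc_self
  have c2 := S.continuousOn_m.mono Ioc_subset_Icc_self
  have c3 := S.continuousOn_ρ.mono Ioc_subset_Icc_self
  have h1 : ∀ χ ∈ Ioc 0 S.B, S.r χ ≠ 0 := fun χ h => (S.r_pos χ h).ne'
  have h2 : ∀ χ ∈ Ioc 0 S.B, S.r χ ^ 2 ≠ 0 := fun χ h => pow_ne_zero 2 (h1 χ h)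
  have h3 : ∀ χ ∈ Ioc 0 S.B, S.r χ ^ 3 ≠ 0 := fun χ h => pow_ne_zero 3 (h1 χ h)
  have h4 : ∀ χ ∈ Ioc 0 S.B, S.lapse χ ≠ 0 := fun χ h => (lapse_pos h).ne'
  have h5 : ∀ χ ∈ Ioc 0 S.B, S.lapse χ ^ 2 ≠ 0 := fun χ h => pow_ne_zero 2 (h4 χ h)
  have c4 : ContinuousOn S.lapse (Ioc 0 S.B) := by
    unfold lapse
    fun_prop (disch := assumption)
  have c5 : ContinuousOn S.force (Ioc 0 S.B) := by
    unfold force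
    fun_prop (disch := assumption)
  have c6 : ContinuousOn S.inertia (Ioc 0 S.B) := by
    unfold inertia
    fun_prop (disch := assumption)
  have c7 : ContinuousOn S.lapseSlope (Ioc 0 S.B) := by
    unfold lapseSlope
    fun_prop (disch := assumption)
  have c8 : ContinuousOn S.forceSlope (Ioc 0 S.B) := by
    unfold forceSlope
    fun_prop (disch := assumption)
  refine ⟨c6, ?_, ?_⟩
  · unfold stiffness
    fun_prop
  · unfold potential zerothOrder
    fun_prop (disch := assumption)

theorem stiffness_bounds (hrad : S.radius < 1 / 100) (hρ : S.ρ 0 < 1 + 1 / 100)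
    (hχ : χ ∈ Ioc 0 S.B) : S.r χ ^ 4 ≤ S.stiffness χ ∧ S.stiffness χ ≤ 400 * S.r χ ^ 4 := by
  obtain ⟨-, ⟨h1, h2⟩, -⟩ := coefficient_bounds hrad hρ hχ
  have h3 := Real.pi_gt_three
  have h4 : Real.pi ≤ 3.15 := Real.pi_lt_d2.le
  have h5 : 0 < S.r χ ^ 4 := pow_pos (S.r_pos χ hχ) 4
  have h6 : 9 ≤ Real.pi ^ 2 := by nlinarith
  have h7 : Real.pi ^ 2 ≤ 10 := by nlinarith
  have h8 : 1 ≤ 16 * Real.pi ^ 2 * S.inertia χ := by nlinarith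
  have h9 : 16 * Real.pi ^ 2 * S.inertia χ ≤ 400 := by nlinarith
  have e : S.stiffness χ = 16 * Real.pi ^ 2 * S.inertia χ * S.r χ ^ 4 := by
    unfold stiffness
    ring
  rw [e]
  constructor <;> nlinarith

theorem isDegenerateWave (hrad : S.radius < 1 / 100) (hρ : S.ρ 0 < 1 + 1 / 100)
    {u : ℝ → ℝ → ℝ} (hu : S.IsMasterSolution u) :
    IsDegenerateWave S.B 4 S.inertia S.stiffness S.potential u (dPhi u) (fun φ => S.dChi (u φ))
      (dPhi (dPhi u)) (fun φ => S.dChi (dPhi u φ)) := by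
  obtain ⟨c1, c2, c3⟩ := continuousOn_coefficients (S := S)
  have h0 : ContDiffOn ℝ 2 (Function.uncurry u) S.domain := hu.contDiffOn
  have h1 : ContDiffOn ℝ ((1 : ℕ) + 1) (Function.uncurry u) S.domain := by
    norm_num
    exact h0
  have hp : ContDiffOn ℝ ((0 : ℕ) + 1) (Function.uncurry (dPhi u)) S.domain := by
    simpa using contDiffOn_dPhi h1
  have hq : ContDiffOn ℝ ((0 : ℕ) + 1) (Function.uncurry fun φ => S.dChi (u φ)) S.domain := by
    simpa using contDiffOn_dChi h1
  refine
    { B_pos := S.B_pos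
      K_pos := by norm_num
      contκ := c1
      contP := c2
      contW := c3
      κ_nonneg := fun χ hχ => by linarith [(coefficient_bounds hrad hρ hχ).2.1.1]
      κ_le := fun χ hχ => by linarith [(coefficient_bounds hrad hρ hχ).2.1.2]
      P_pos := fun χ hχ =>
        (pow_pos (S.r_pos χ hχ) 4).trans_le (stiffness_bounds hrad hρ hχ).1
      P_le := fun χ hχ => ?_
      W_nonneg := fun χ hχ => le_trans (by positivity) (coefficient_bounds hrad hρ hχ).2.2.2.1
      contu := h0.continuousOn
      contp := hp.continuousOn
      contq := hq.continuousOn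
      contpt := (contDiffOn_dPhi hp).continuousOn
      contpx := (contDiffOn_dChi hp).continuousOn
      u_t := fun t ht x hx => hasDerivWithinAt_dPhi h1 ⟨ht, hx⟩
      p_t := fun t ht x hx => hasDerivWithinAt_dPhi hp ⟨ht, hx⟩
      q_t := fun t ht x hx =>
        (hasDerivWithinAt_dPhi hq ⟨ht, hx⟩).congr_deriv (dPhi_dChi h0 ⟨ht, hx⟩)
      u_x := fun t ht x hx => hasDerivAt_dChi h1 ht hx
      p_x := fun t ht x hx => hasDerivAt_dChi hp ht hx
      equation := fun t ht x hx => hasDerivAt_stiffness_mul_dChi hx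
        (hu.equation t ht x (Ioo_subset_Ioc_self hx)) (hasDerivAt_dChi h1 ht hx)
        (hasDerivAt_dChi hq ht hx)
      bounded := fun T => ?_ }
  -- Here `K = 4` arises: `P ≤ 400 r⁴ ≤ 400 · (1/100) r³ ≤ 4 χ`.
  · have h2 := (stiffness_bounds hrad hρ hχ).2
    have h3 := r_pow_three_le (Ioc_subset_Icc_self hχ)
    have h4 : S.r χ ≤ 1 / 100 := (r_le_radius (Ioc_subset_Icc_self hχ)).trans hrad.le
    have h5 := S.r_pos χ hχ
    have h6 : S.r χ ^ 4 ≤ 1 / 100 * χ := by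
      calc S.r χ ^ 4 = S.r χ * S.r χ ^ 3 := by ring
        _ ≤ 1 / 100 * χ := by gcongr
    linarith
  -- Continuity of `r₁` and `∂_φr₁` up to the center enters here, through compactness of `[0, T] ×
  -- [0, B]`.
  · have hsub : Icc (0 : ℝ) T ×ˢ Icc 0 S.B ⊆ Ici 0 ×ˢ Icc 0 S.B :=
      prod_mono_left Icc_subset_Ici_self
    obtain ⟨C₁, hC₁⟩ := (isCompact_Icc.prod isCompact_Icc).exists_bound_of_continuousOn
      (hu.continuousOn.mono hsub)
    obtain ⟨C₂, hC₂⟩ := (isCompact_Icc.prod isCompact_Icc).exists_bound_of_continuousOn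
      (hu.continuousOn_dPhi.mono hsub)
    exact ⟨max C₁ C₂, fun t ht x hx =>
      ⟨(hC₁ (t, x) ⟨ht, Ioc_subset_Icc_self hx⟩).trans (le_max_left _ _),
        (hC₂ (t, x) ⟨ht, Ioc_subset_Icc_self hx⟩).trans (le_max_right _ _)⟩⟩

end HardStar

/-! ### Integral comparison and a trace inequality -/

theorem setLIntegral_ofReal_le_mul {f g : ℝ → ℝ} {s : Set ℝ} {C : ℝ} (hs : MeasurableSet s)
    (hC : 0 ≤ C) (hfg : ∀ x ∈ s, f x ≤ C * g x) :
    ∫⁻ x in s, ENNReal.ofReal (f x) ≤ ENNReal.ofReal C * ∫⁻ x in s, ENNReal.ofReal (g x) := by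
  rw [← lintegral_const_mul' _ _ ENNReal.ofReal_ne_top]
  refine setLIntegral_mono' hs fun x hx => ?_
  rw [← ENNReal.ofReal_mul hC]
  exact ENNReal.ofReal_le_ofReal (hfg x hx)

/-- Integrate the derivative of `(x - a) f²`, whose value at `a` vanishes, and apply `2 f f' ≤ f² +
f'²`. -/
theorem ofReal_sq_right_endpoint_le {f f' : ℝ → ℝ} {a b : ℝ} (hab : a < b)
    (hf : ContinuousOn f (Icc a b)) (hf' : ContinuousOn f' (Icc a b))
    (hd : ∀ x ∈ Ioo a b, HasDerivAt f (f' x) x) :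
    ENNReal.ofReal ((b - a) * f b ^ 2)
      ≤ ∫⁻ x in Ioc a b, ENNReal.ofReal (f x ^ 2 + (b - a) * (f x ^ 2 + f' x ^ 2)) := by
  have hab' : 0 < b - a := sub_pos.2 hab
  have hint : ∫ x in a..b, (f x ^ 2 + (x - a) * (2 * f x * f' x)) = (b - a) * f b ^ 2 := by
    rw [intervalIntegral.integral_eq_sub_of_hasDerivAt_of_le (f := fun x => (x - a) * f x ^ 2)
      hab.le (by fun_prop) (fun x hx => ?_)
      (ContinuousOn.intervalIntegrable_of_Icc hab.le (by fun_prop))]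
    · ring
    · refine (((hasDerivAt_id x).sub_const a).mul ((hd x hx).pow 2)).congr_deriv ?_
      simp
  have hle : (b - a) * f b ^ 2 ≤ ∫ x in a..b, (f x ^ 2 + (b - a) * (f x ^ 2 + f' x ^ 2)) := by
    rw [← hint]
    refine intervalIntegral.integral_mono_on hab.le
      (ContinuousOn.intervalIntegrable_of_Icc hab.le (by fun_prop))
      (ContinuousOn.intervalIntegrable_of_Icc hab.le (by fun_prop)) (fun x hx => ?_)
    have h1 : 2 * f x * f' x ≤ f x ^ 2 + f' x ^ 2 := two_mul_le_add_sq _ _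
    have h2 : 0 ≤ x - a := sub_nonneg.2 hx.1
    have h3 : x - a ≤ b - a := by linarith [hx.2]
    have h4 : 0 ≤ f x ^ 2 + f' x ^ 2 := by positivity
    nlinarith
  refine (ENNReal.ofReal_le_ofReal hle).trans_eq ?_
  rw [intervalIntegral.integral_of_le hab.le, ofReal_integral_eq_lintegral_ofReal]
  · exact (ContinuousOn.integrableOn_Icc (by fun_prop)).mono_set Ioc_subset_Icc_self
  · exact Eventually.of_forall fun x => by positivity

/-! ### Equivalence of energies and the final estimates -/

namespace HardStar

variable {S : HardStar} {χ : ℝ} {u : ℝ → ℝ → ℝ} {φ : ℝ}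

theorem energyDensity_le_density (hrad : S.radius < 1 / 100) (hρ : S.ρ 0 < 1 + 1 / 100)
    (hχ : χ ∈ Ioc 0 S.B) :
    u φ χ ^ 2 / S.r χ ^ 2 + dPhi u φ χ ^ 2 + S.r χ ^ 4 * S.dChi (u φ) χ ^ 2
      ≤ 1 * IsDegenerateWave.density S.inertia S.stiffness S.potential u (dPhi u)
        (fun φ => S.dChi (u φ)) φ χ := by
  obtain ⟨-, ⟨h1, -⟩, -, h2, -⟩ := coefficient_bounds hrad hρ hχ
  have h3 := (stiffness_bounds hrad hρ hχ).1
  have e : u φ χ ^ 2 / S.r χ ^ 2 = 1 / S.r χ ^ 2 * u φ χ ^ 2 := by ring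
  rw [one_mul, IsDegenerateWave.density, e]
  have b1 := mul_le_mul_of_nonneg_right h1 (sq_nonneg (dPhi u φ χ))
  have b2 := mul_le_mul_of_nonneg_right h2 (sq_nonneg (u φ χ))
  have b3 := mul_le_mul_of_nonneg_right h3 (sq_nonneg (S.dChi (u φ) χ))
  linarith

theorem density_le_energyDensity (hrad : S.radius < 1 / 100) (hρ : S.ρ 0 < 1 + 1 / 100)
    (hχ : χ ∈ Ioc 0 S.B) :
    IsDegenerateWave.density S.inertia S.stiffness S.potential u (dPhi u)
        (fun φ => S.dChi (u φ)) φ χ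
      ≤ 400 * (u φ χ ^ 2 / S.r χ ^ 2 + dPhi u φ χ ^ 2 + S.r χ ^ 4 * S.dChi (u φ) χ ^ 2) := by
  obtain ⟨-, ⟨-, h1⟩, -, -, h2⟩ := coefficient_bounds hrad hρ hχ
  have h3 := (stiffness_bounds hrad hρ hχ).2
  have e : 4 / S.r χ ^ 2 * u φ χ ^ 2 = 4 * (u φ χ ^ 2 / S.r χ ^ 2) := by ring
  have h4 : 0 ≤ u φ χ ^ 2 / S.r χ ^ 2 := by positivity
  rw [IsDegenerateWave.density]
  have b1 := mul_le_mul_of_nonneg_right h1 (sq_nonneg (dPhi u φ χ))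
  have b2 := mul_le_mul_of_nonneg_right h2 (sq_nonneg (u φ χ))
  have b3 := mul_le_mul_of_nonneg_right h3 (sq_nonneg (S.dChi (u φ) χ))
  have b4 := sq_nonneg (dPhi u φ χ)
  linarith

/-- By `g⁻² = P ≤ 400 r⁴` and `F/a ≤ 1 ≤ 1/r`, each of `ψ₁²`, `ω₁²` costs at most 800 times the
energy density. Each of `ρ₁²`, `n₁²` is at most `2 ψ₁²`, which gives 4800 in total. -/
theorem linearised_sq_le (hrad : S.radius < 1 / 100) (hρ : S.ρ 0 < 1 + 1 / 100)
    (hχ : χ ∈ Ioc 0 S.B) :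
    S.linRho u φ χ ^ 2 + S.linN u φ χ ^ 2 + S.linPsi u φ χ ^ 2 + S.linOmega u φ χ ^ 2
      ≤ 4800 * (u φ χ ^ 2 / S.r χ ^ 2 + dPhi u φ χ ^ 2 + S.r χ ^ 4 * S.dChi (u φ) χ ^ 2) := by
  obtain ⟨⟨ha, -⟩, -, hs, -⟩ := coefficient_bounds hrad hρ hχ
  have hχ' := Ioc_subset_Icc_self hχ
  have hr := S.r_pos χ hχ
  have hr1 : S.r χ ≤ 1 / 100 := (r_le_radius hχ').trans hrad.le
  have hg := rSlope_pos hχ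
  have hP := (stiffness_bounds hrad hρ hχ).2
  have hs0 : 0 < S.force χ / S.lapse χ := div_pos (force_pos hχ) (lapse_pos hχ)
  have hn := two_mul_ρ_sub_one_pos hχ'
  have hn2 : 2 * S.ρ χ - 1 ≤ 102 / 100 := by
    have := ρ_le hχ'
    linarith
  have hir : 1 ≤ 1 / S.r χ := by
    rw [le_div_iff₀ hr]
    linarith
  have hq : (S.dChi (u φ) χ / S.rSlope χ) ^ 2 ≤ 400 * (S.r χ ^ 4 * S.dChi (u φ) χ ^ 2) := by
    have h1 := rSlope_sq_mul_stiffness hχ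
    have e : (S.dChi (u φ) χ / S.rSlope χ) ^ 2 = S.stiffness χ * S.dChi (u φ) χ ^ 2 := by
      field_simp
      linear_combination -S.dChi (u φ) χ ^ 2 * h1
    rw [e]
    have := mul_le_mul_of_nonneg_right hP (sq_nonneg (S.dChi (u φ) χ))
    linarith
  have hu1 : ((2 / S.r χ - S.force χ / S.lapse χ) * u φ χ) ^ 2
      ≤ 4 * (u φ χ ^ 2 / S.r χ ^ 2) := by
    have h1 : 2 / S.r χ = 2 * (1 / S.r χ) := by ring
    have h2 : (2 / S.r χ - S.force χ / S.lapse χ) ^ 2 ≤ (2 / S.r χ) ^ 2 :=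
      pow_le_pow_left₀ (by linarith) (by linarith) 2
    calc _ = (2 / S.r χ - S.force χ / S.lapse χ) ^ 2 * u φ χ ^ 2 := by ring
      _ ≤ (2 / S.r χ) ^ 2 * u φ χ ^ 2 := mul_le_mul_of_nonneg_right h2 (sq_nonneg _)
      _ = _ := by ring
  have hu2 : (S.force χ / S.lapse χ * u φ χ) ^ 2 ≤ u φ χ ^ 2 / S.r χ ^ 2 := by
    have h2 : (S.force χ / S.lapse χ) ^ 2 ≤ (1 / S.r χ) ^ 2 :=
      pow_le_pow_left₀ hs0.le (by linarith) 2
    calc _ = (S.force χ / S.lapse χ) ^ 2 * u φ χ ^ 2 := by ring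
      _ ≤ (1 / S.r χ) ^ 2 * u φ χ ^ 2 := mul_le_mul_of_nonneg_right h2 (sq_nonneg _)
      _ = _ := by ring
  have hE1 : 0 ≤ u φ χ ^ 2 / S.r χ ^ 2 := by positivity
  have hE2 := sq_nonneg (dPhi u φ χ)
  have hE3 : 0 ≤ S.r χ ^ 4 * S.dChi (u φ) χ ^ 2 := by positivity
  have hpsi : S.linPsi u φ χ ^ 2
      ≤ 800 * (u φ χ ^ 2 / S.r χ ^ 2 + dPhi u φ χ ^ 2 + S.r χ ^ 4 * S.dChi (u φ) χ ^ 2) := by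
    rw [linPsi, psiSlope_eq hχ, dChi_r hχ]
    refine add_sq_le.trans ?_
    linarith
  have homega : S.linOmega u φ χ ^ 2
      ≤ 800 * (u φ χ ^ 2 / S.r χ ^ 2 + dPhi u φ χ ^ 2 + S.r χ ^ 4 * S.dChi (u φ) χ ^ 2) := by
    rw [linOmega, psiSlope_eq hχ, dChi_r hχ, sub_eq_add_neg]
    refine add_sq_le.trans ?_
    rw [neg_sq]
    linarith
  have hrho : S.linRho u φ χ ^ 2 ≤ 2 * S.linPsi u φ χ ^ 2 := by
    have h1 : (2 * S.ρ χ - 1) ^ 2 ≤ 2 := by nlinarith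
    rw [linRho, mul_pow, neg_sq, mul_comm]
    exact mul_le_mul_of_nonneg_right h1 (sq_nonneg _)
  have hlinN : S.linN u φ χ ^ 2 ≤ 2 * S.linPsi u φ χ ^ 2 := by
    have e : S.linN u φ χ ^ 2 = (2 * S.ρ χ - 1) * S.linPsi u φ χ ^ 2 := by
      rw [linN, linRho, div_pow, Real.sq_sqrt hn.le]
      field_simp
    rw [e]
    exact mul_le_mul_of_nonneg_right (by linarith) (sq_nonneg _)
  linarith

/-- The value of a solution at the boundary of the star is controlled by its energy. -/
theorem exists_ofReal_sq_boundary_le (hrad : S.radius < 1 / 100) (hρ : S.ρ 0 < 1 + 1 / 100) :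
    ∃ C : ℝ, 0 < C ∧ ∀ u, S.IsMasterSolution u → ∀ φ, 0 ≤ φ →
      ENNReal.ofReal (u φ S.B ^ 2) ≤ ENNReal.ofReal C * S.energy u φ := by
  have hB := S.B_pos
  have hmid : S.B / 2 ∈ Ioc 0 S.B := ⟨by linarith, by linarith⟩
  have hr0 := S.r_pos _ hmid
  -- The trace inequality is applied on `[B/2, B]`, away from the center, where `r⁴` is at least its
  -- value at `B/2`.
  refine ⟨(1 + S.B / 2 + S.B / 2 / S.r (S.B / 2) ^ 4) / (S.B / 2), by positivity,
    fun u hu φ hφ => ?_⟩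
  have h := isDegenerateWave hrad hρ hu
  have hsub : Icc (S.B / 2) S.B ⊆ Ioc 0 S.B := fun x hx => ⟨by linarith [hx.1], hx.2⟩
  have key := ofReal_sq_right_endpoint_le (f := u φ) (f' := fun x => S.dChi (u φ) x)
    (show S.B / 2 < S.B by linarith)
    ((IsDegenerateWave.continuousOn_snd_slice h.contu hφ).mono hsub)
    ((IsDegenerateWave.continuousOn_snd_slice h.contq hφ).mono hsub)
    (fun x hx => h.u_x φ hφ x ⟨by linarith [hx.1], hx.2⟩)
  rw [show S.B - S.B / 2 = S.B / 2 by ring, ENNReal.ofReal_mul (by positivity)] at key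
  rw [ENNReal.ofReal_div_of_pos (by positivity), div_eq_mul_inv, mul_right_comm,
    ← div_eq_mul_inv, ENNReal.le_div_iff_mul_le (Or.inl (by simpa using hB))
      (Or.inl ENNReal.ofReal_ne_top), mul_comm]
  refine key.trans ?_
  refine (setLIntegral_ofReal_le_mul (g := fun χ => u φ χ ^ 2 / S.r χ ^ 2 + dPhi u φ χ ^ 2
    + S.r χ ^ 4 * S.dChi (u φ) χ ^ 2) (C := 1 + S.B / 2 + S.B / 2 / S.r (S.B / 2) ^ 4)
    measurableSet_Ioc (by positivity) fun x hx => ?_).trans ?_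
  · have hx' : x ∈ Ioc 0 S.B := hsub (Ioc_subset_Icc_self hx)
    have hr := S.r_pos x hx'
    have hr1 : S.r x ≤ 1 := (r_le_radius (Ioc_subset_Icc_self hx')).trans (by linarith)
    have hrm : S.r (S.B / 2) ≤ S.r x := monotoneOn_of_hasDerivWithinAt S.continuousOn_r
      (fun _ h => hasDerivWithinAt_r h) (fun _ h => (rSlope_pos h).le)
      (Ioc_subset_Icc_self hmid) (Ioc_subset_Icc_self hx') hx.1.le
    set E := u φ x ^ 2 / S.r x ^ 2 + dPhi u φ x ^ 2 + S.r x ^ 4 * S.dChi (u φ) x ^ 2 with hE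
    have hE1 : 0 ≤ u φ x ^ 2 / S.r x ^ 2 := by positivity
    have hE2 := sq_nonneg (dPhi u φ x)
    have hE3 : 0 ≤ S.r x ^ 4 * S.dChi (u φ) x ^ 2 := by positivity
    have b1 : u φ x ^ 2 ≤ E := by
      have : u φ x ^ 2 ≤ u φ x ^ 2 / S.r x ^ 2 := by
        rw [le_div_iff₀ (by positivity)]
        exact mul_le_of_le_one_right (sq_nonneg _) (pow_le_one₀ hr.le hr1)
      linarith
    have b2 : S.dChi (u φ) x ^ 2 ≤ E / S.r (S.B / 2) ^ 4 := by
      rw [le_div_iff₀ (by positivity)]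
      have : S.dChi (u φ) x ^ 2 * S.r (S.B / 2) ^ 4 ≤ S.dChi (u φ) x ^ 2 * S.r x ^ 4 := by gcongr
      linarith
    have b3 : S.B / 2 * S.dChi (u φ) x ^ 2 ≤ S.B / 2 * (E / S.r (S.B / 2) ^ 4) := by gcongr
    have b4 : S.B / 2 * u φ x ^ 2 ≤ S.B / 2 * E := by gcongr
    have e : S.B / 2 * (E / S.r (S.B / 2) ^ 4) = S.B / 2 / S.r (S.B / 2) ^ 4 * E := by ring
    linarith
  · refine mul_le_mul_right ?_ _
    exact lintegral_mono_set (Ioc_subset_Ioc_left hmid.1.le)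

/-- The sign `κ ≥ 0`, together with `F/a ≤ 1 ≤ 2/r` at the boundary, makes the Robin coefficient `c`
nonnegative. Leaving `κ` free treats both forms of the boundary condition at once. -/
theorem exists_energy_le (hrad : S.radius < 1 / 100) (hρ : S.ρ 0 < 1 + 1 / 100) {κ : ℝ}
    (hκ : 0 ≤ κ) :
    ∃ C : ℝ, 0 < C ∧ ∀ u, S.IsMasterSolution u → S.BoundaryCondition κ u → ∀ φ, 0 ≤ φ →
      S.energy u φ ≤ ENNReal.ofReal C * S.energy u 0 := by
  obtain ⟨C, hC, hbd⟩ := exists_ofReal_sq_boundary_le hrad hρ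
  have hrB := S.r_pos S.B B_mem
  have hP := (stiffness_bounds hrad hρ B_mem).1
  have hP0 : 0 ≤ S.stiffness S.B := le_trans (by positivity) hP
  have hs : S.psiSlope S.B ≤ 2 / S.r S.B := by
    rw [psiSlope_eq B_mem]
    refine (coefficient_bounds hrad hρ B_mem).2.2.1.trans ?_
    rw [le_div_iff₀ hrB]
    have : S.r S.B < 1 / 100 := hrad
    linarith
  set c := S.stiffness S.B * (κ * (2 / S.r S.B - S.psiSlope S.B)) with hc
  have hc0 : 0 ≤ c := mul_nonneg hP0 (mul_nonneg hκ (by linarith))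
  refine ⟨400 + c * C, by positivity, fun u hu hκu φ hφ => ?_⟩
  have h := isDegenerateWave hrad hρ hu
  have h1 := h.lintegral_density_le hφ hc0 fun t ht => by
    rw [hκu t ht, hc]
    ring
  calc S.energy u φ ≤ ENNReal.ofReal 1 * _ :=
        setLIntegral_ofReal_le_mul measurableSet_Ioc zero_le_one
          fun x hx => energyDensity_le_density hrad hρ hx
    _ ≤ ENNReal.ofReal 400 * S.energy u 0
        + ENNReal.ofReal c * (ENNReal.ofReal C * S.energy u 0) := by
      rw [ENNReal.ofReal_one, one_mul]
      refine h1.trans (add_le_add ?_ ?_)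
      · exact setLIntegral_ofReal_le_mul measurableSet_Ioc (by norm_num)
          fun x hx => density_le_energyDensity hrad hρ hx
      · rw [ENNReal.ofReal_mul hc0]
        exact mul_le_mul_right (hbd u hu 0 le_rfl) _
    _ = _ := by
      rw [← mul_assoc, ← add_mul, ← ENNReal.ofReal_mul hc0,
        ← ENNReal.ofReal_add (by norm_num) (by positivity)]

end HardStar

theorem proposition4p2 :
    ∃ ε : ℝ, 0 < ε ∧ ∀ S : HardStar, S.radius < ε → S.ρ 0 < 1 + ε →
      ∃ C : ℝ, 0 < C ∧ ∀ r₁ : ℝ → ℝ → ℝ, S.IsMasterSolution r₁ →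
        (S.BoundaryCondition 1 r₁ ∨ S.BoundaryCondition (S.dChi S.r S.B) r₁) →
        ∀ φ : ℝ, 0 ≤ φ →
          S.energy r₁ φ ≤ ENNReal.ofReal C * S.energy r₁ 0 ∧
          ∫⁻ χ in Set.Ioc 0 S.B, ENNReal.ofReal
              (S.linRho r₁ φ χ ^ 2 + S.linN r₁ φ χ ^ 2
                + S.linPsi r₁ φ χ ^ 2 + S.linOmega r₁ φ χ ^ 2)
            ≤ ENNReal.ofReal C * S.energy r₁ 0 := by
  refine ⟨1 / 100, by norm_num, fun S hrad hρ => ?_⟩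
  have hslope : 0 ≤ S.dChi S.r S.B := by
    rw [HardStar.dChi_r HardStar.B_mem]
    exact (HardStar.rSlope_pos HardStar.B_mem).le
  obtain ⟨C₁, hC₁, h₁⟩ := HardStar.exists_energy_le hrad hρ zero_le_one
  obtain ⟨C₂, hC₂, h₂⟩ := HardStar.exists_energy_le hrad hρ hslope
  refine ⟨4800 * (C₁ + C₂), by positivity, fun u hu hbc φ hφ => ?_⟩
  have henergy : S.energy u φ ≤ ENNReal.ofReal (C₁ + C₂) * S.energy u 0 := by
    rcases hbc with hbc | hbc
    · exact (h₁ u hu hbc φ hφ).trans (by gcongr; linarith)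
    · exact (h₂ u hu hbc φ hφ).trans (by gcongr; linarith)
  refine ⟨henergy.trans (by gcongr; linarith), ?_⟩
  refine (setLIntegral_ofReal_le_mul measurableSet_Ioc (C := 4800) (by norm_num)
    fun x hx => HardStar.linearised_sq_le hrad hρ hx).trans ?_
  rw [ENNReal.ofReal_mul (by norm_num), mul_assoc]
  gcongr
  exact henergy
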